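/- **Conventions.** Graphs are finite and simple; $v\simeq w$ means that $v,w$ are adjacent or equal. $G\sqcup H$ is the disjoint union, $G\boxtimes H$ the strong product ($(g,h)\simeq(g',h')$ iff $g\simeq g'$ and $h\simeq h'$), $G^{\boxtimes n}$ the $n$-fold strong power with vertex set $V(G)^n$, $G[S]$ the subgraph induced on $S$, and $\overline{G}$ the complement. Write $H\le G$ if there is a graph homomorphism $\overline H\to\overline G$. Logarithms are to base $2$. A *spectral point* is a map $f$ from graphs to $\mathbb{R}_{\ge 0}$ with $f(G\sqcup H)=f(G)+f(H)$, $f(G\boxtimes H)=f(G)f(H)$, $f(H)\le f(G)$ whenever $H\le G$, and $f(\overline{K_d})=d$. A probability distribution $Q$ on $V(G)$ is an $n$-type if $nQ(a)\in\mathbb{N}$ for all $a$; its type class $T^n_Q\subseteq V(G)^n$ is the set of strings in which each letter $a$ occurs exactly $nQ(a)$ times. The *probabilistic refinement* of $f$ is the function $F$ with $$F(G,P)=\lim_{n\to\infty}\tfrac1n\log f\big(G^{\boxtimes n}[T^n_{P^{(n)}}]\big)$$ for every graph $G$, every probability distribution $P$ on $V(G)$ and every sequence of $n$-types $P^{(n)}\to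 P$. For a probability measure $\mu$ on $V(G)^\infty$ let $\mu_{1\ldots n}$ be its marginal on the first $n$ letters. The pair $(G,\mu)$ has the *(generalized) asymptotic equipartition property* if for every spectral point $f$ the limit $$\lim_{n\to\infty}\ \min_{S\subseteq V(G)^n,\ \mu_{1\ldots n}(S)\ge c}\ \tfrac1n\log f(G^{\boxtimes n}[S])$$ exists for every $c\in(0,1)$ and is independent of $c$. Let $P$ be a probability distribution on $V(G)\times V(G)$ with equal marginals $P_1=P_2$, and let $\mu^P$ be the law on $V(G)^\infty$ of the stationary Markov chain with initial distribution $P_1$ and transition probabilities $W(b|a)=P(a,b)/P_1(a)$, i.e. $\mu^P_{1\ldots n}(x_1\ldots x_n)=P_1(x_1)\prod_{i=1}^{n-1}W(x_{i+1}|x_i)$. **Theorem.** Let $G$ be a graph, and let $P$ be a probability distribution on $V(G)\times V(G)$ with equal marginals such that the Markov chain above is irreducible on the support of $P_1$. Then $(G,\mu^P)$ has the asymptotic equipartition property. More precisely, every spectral point $f$ has a unique probabilistic refinement $F$, the limit $\lim_{n\to\infty}\frac1nF(G^{\boxtimes n},\mu^P_{1\ldots n})$ (the $F$-rate) exists, and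 for every $c\in(0,1)$ $$\lim_{n\to\infty}\ \min_{S\subseteq V(G)^n,\ \mu^P_{1\ldots n}(S)\ge c}\ \tfrac1n\log f(G^{\boxtimes n}[S])=\lim_{n\to\infty}\tfrac1nF(G^{\boxtimes n},\mu^P_{1\ldots n}).$$ -/

import Mathlib

open Filter Topology MeasureTheory

universe u

namespace AmbiguousAlphabet

/-! ### Confusability graphs -/

/-- The strong product: `(v, w) ≃ (v', w')` iff `v ≃ v'` and `w ≃ w'`,
where `≃` means "adjacent or equal". -/
def strongProduct {V W : Type u} (G : SimpleGraph V) (H : SimpleGraph W) :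
    SimpleGraph (V × W) where
  Adj p q := p ≠ q ∧ (p.1 = q.1 ∨ G.Adj p.1 q.1) ∧ (p.2 = q.2 ∨ H.Adj p.2 q.2)
  symm := ⟨fun _ _ h =>
    ⟨h.1.symm, h.2.1.imp Eq.symm fun e => e.symm, h.2.2.imp Eq.symm fun e => e.symm⟩⟩
  loopless := ⟨fun _ h => h.1 rfl⟩

/-- The `n`-fold strong power, on strings of length `n`: two distinct strings are
confusable iff they are confusable or equal in every coordinate. -/
def strongPower {V : Type u} (G : SimpleGraph V) (n : ℕ) : SimpleGraph (Fin n → V) where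
  Adj x y := x ≠ y ∧ ∀ i, x i = y i ∨ G.Adj (x i) (y i)
  symm := ⟨fun _ _ h => ⟨h.1.symm, fun i => (h.2 i).imp Eq.symm fun e => e.symm⟩⟩
  loopless := ⟨fun _ h => h.1 rfl⟩

/-- The cohomomorphism preorder `H ≤ G`: there is a homomorphism between the complements. -/
def CohomLE {V W : Type u} (H : SimpleGraph W) (G : SimpleGraph V) : Prop :=
  Nonempty (Hᶜ →g Gᶜ)

/-! ### The asymptotic spectrum of graphs -/

/-- A real-valued parameter of finite graphs. -/
abbrev GraphParameter : Type (u + 1) :=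
  ∀ (V : Type u) [Finite V], SimpleGraph V → ℝ

/-- The points of the asymptotic spectrum of graphs. -/
structure IsSpectralPoint (f : GraphParameter.{u}) : Prop where
  nonneg : ∀ (V : Type u) [Finite V] (G : SimpleGraph V), 0 ≤ f V G
  add : ∀ (V W : Type u) [Finite V] [Finite W] (G : SimpleGraph V) (H : SimpleGraph W),
    f (V ⊕ W) (G ⊕g H) = f V G + f W H
  mul : ∀ (V W : Type u) [Finite V] [Finite W] (G : SimpleGraph V) (H : SimpleGraph W),
    f (V × W) (strongProduct G H) = f V G * f W H
  mono : ∀ (V W : Type u) [Finite V] [Finite W] (G : SimpleGraph V) (H : SimpleGraph W),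
    CohomLE H G → f W H ≤ f V G
  edgeless : ∀ (V : Type u) [Finite V], f V (⊥ : SimpleGraph V) = (Nat.card V : ℝ)

/-! ### Types and probabilistic refinements

Probability distributions on a finite set `V` are the elements of `stdSimplex ℝ V`. -/

/-- `Q` is an `n`-type: all its probabilities are integer multiples of `1 / n`. -/
def IsNType {V : Type u} [Fintype V] (n : ℕ) (Q : stdSimplex ℝ V) : Prop :=
  ∀ a, ∃ k : ℕ, (n : ℝ) * Q a = k

open Classical in
/-- The type class of `Q`: the strings of length `n` in which each letter `a` occurs
exactly `n * Q a` times. -/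
def typeClass {V : Type u} [Fintype V] (n : ℕ) (Q : stdSimplex ℝ V) : Set (Fin n → V) :=
  {x | ∀ a, ((Finset.univ.filter fun i => x i = a).card : ℝ) = n * Q a}

/-- The subgraph of the strong power induced on a type class. -/
def typeGraph {V : Type u} [Fintype V] (G : SimpleGraph V) (n : ℕ) (Q : stdSimplex ℝ V) :
    SimpleGraph (typeClass n Q) :=
  (strongPower G n).induce (typeClass n Q)

/-- A real-valued function of finite graphs with a probability distribution on the vertices. -/
abbrev ProbabilisticGraphParameter : Type (u + 1) :=
  ∀ (V : Type u) [Fintype V], SimpleGraph V → stdSimplex ℝ V → ℝ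

/-- `F` is the (logarithmic) probabilistic refinement of `f`: for every graph `G` and every
distribution `P` on its vertices, `F(G, P)` is the limit of `(1/n) log f` of the type graphs
along every sequence of `n`-types that converges to `P`. -/
def IsProbabilisticRefinement (f : GraphParameter.{u}) (F : ProbabilisticGraphParameter.{u}) :
    Prop :=
  ∀ (V : Type u) [Fintype V] (G : SimpleGraph V) (P : stdSimplex ℝ V)
    (Q : ℕ → stdSimplex ℝ V), (∀ n, IsNType n (Q n)) → Tendsto Q atTop (𝓝 P) →
    Tendsto (fun n : ℕ => (1 / (n : ℝ)) * Real.logb 2 (f _ (typeGraph G n (Q n)))) atTop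
      (𝓝 (F V G P))

/-! ### Sources and the asymptotic equipartition property -/

section Sources

variable {V : Type u} [Fintype V] [MeasurableSpace V]

/-- The first `n` letters of an infinite word. -/
def initialBlock {V : Type u} (n : ℕ) (ω : ℕ → V) : Fin n → V := fun i => ω i

theorem measurable_initialBlock {V : Type u} [MeasurableSpace V] (n : ℕ) :
    Measurable (initialBlock (V := V) n) :=
  measurable_pi_lambda _ fun i => measurable_pi_apply (i : ℕ)

/-- The marginal of `μ` on the first `n` letters. -/
noncomputable def blockLaw {V : Type u} [MeasurableSpace V] (μ : Measure (ℕ → V)) (n : ℕ) : Measure (Fin n → V) :=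
  μ.map (initialBlock n)

instance blockLaw_isProbabilityMeasure {V : Type u} [MeasurableSpace V] (μ : Measure (ℕ → V))
    [IsProbabilityMeasure μ] (n : ℕ) : IsProbabilityMeasure (blockLaw μ n) :=
  Measure.isProbabilityMeasure_map (measurable_initialBlock n).aemeasurable

/-- A probability measure on a finite set as a vector of probabilities. -/
noncomputable def probVector {X : Type u} [Fintype X] [MeasurableSpace X]
    [MeasurableSingletonClass X] (ν : Measure X) [IsProbabilityMeasure ν] : stdSimplex ℝ X :=
  ⟨fun a => ν.real {a}, fun _ => measureReal_nonneg, by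
    simp⟩

/-- The minimum, over all sets `S` of strings of length `n` with probability at least `c`,
of `(1/n) log f` of the induced subgraph of the strong power on `S`. -/
noncomputable def minRate (f : GraphParameter.{u}) (G : SimpleGraph V) (μ : Measure (ℕ → V))
    (c : ℝ) (n : ℕ) : ℝ :=
  ⨅ S : {S : Set (Fin n → V) // c ≤ (blockLaw μ n).real S},
    (1 / (n : ℝ)) * Real.logb 2 (f _ ((strongPower G n).induce S.1))

/-- For a probability measure and `c ≤ 1` the infimum in `minRate` is a minimum. -/
theorem minRate_isLeast (f : GraphParameter.{u}) (G : SimpleGraph V) (μ : Measure (ℕ → V))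
    [IsProbabilityMeasure μ] {c : ℝ} (hc : c ≤ 1) (n : ℕ) :
    IsLeast {r : ℝ | ∃ S : Set (Fin n → V), c ≤ (blockLaw μ n).real S ∧
      r = (1 / (n : ℝ)) * Real.logb 2 (f _ ((strongPower G n).induce S))}
      (minRate f G μ c n) := by
  have : Nonempty {S : Set (Fin n → V) // c ≤ (blockLaw μ n).real S} :=
    ⟨⟨Set.univ, by simpa using hc⟩⟩
  obtain ⟨S, hS⟩ := exists_eq_ciInf_of_finite
    (f := fun S : {S : Set (Fin n → V) // c ≤ (blockLaw μ n).real S} =>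
      (1 / (n : ℝ)) * Real.logb 2 (f _ ((strongPower G n).induce S.1)))
  refine ⟨⟨S.1, S.2, hS.symm⟩, ?_⟩
  rintro r ⟨T, hT, rfl⟩
  exact ciInf_le (Set.finite_range _).bddBelow
    (⟨T, hT⟩ : {S : Set (Fin n → V) // c ≤ (blockLaw μ n).real S})

/-- The asymptotic equipartition property of a source `μ` with confusability graph `G`:
for every spectral point the limit exists and does not depend on `c`. -/
def HasAEP (G : SimpleGraph V) (μ : Measure (ℕ → V)) : Prop :=
  ∀ f : GraphParameter.{u}, IsSpectralPoint f →
    ∃ L : ℝ, ∀ c : ℝ, 0 < c → c < 1 → Tendsto (minRate f G μ c) atTop (𝓝 L)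

/-- `r` is the `F`-rate of `(G, μ)`. -/
def IsFRate [DiscreteMeasurableSpace V] (F : ProbabilisticGraphParameter.{u}) (G : SimpleGraph V) (μ : Measure (ℕ → V))
    [IsProbabilityMeasure μ] (r : ℝ) : Prop :=
  Tendsto (fun n : ℕ => (1 / (n : ℝ)) * F (Fin n → V) (strongPower G n)
    (probVector (blockLaw μ n))) atTop (𝓝 r)

end Sources

/-! ### Stationary Markov chains -/

section Markov

variable {V : Type u} [Fintype V]

/-- The first marginal of a distribution on pairs. -/
noncomputable def fstMarginal (P : stdSimplex ℝ (V × V)) : stdSimplex ℝ V :=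
  ⟨fun a => ∑ b, P (a, b), fun _ => Finset.sum_nonneg fun _ _ => P.2.1 _, by
    rw [← Fintype.sum_prod_type']; exact P.2.2⟩

/-- The pair distributions with equal marginals for which the corresponding Markov chain is
irreducible on the support of the first marginal: any letter of positive probability can be
reached from any other one in finitely many (and at least one) transitions of positive
probability. -/
structure IsIrreducibleStationary (P : stdSimplex ℝ (V × V)) : Prop where
  marginals_eq : ∀ a, ∑ b, P (a, b) = ∑ b, P (b, a)
  irreducible : ∀ a b, 0 < fstMarginal P a → 0 < fstMarginal P b →
    Relation.TransGen (fun x y => 0 < P (x, y)) a b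

open Classical in
/-- The transition probabilities `W(b|a) = P(a, b) / P₁(a)`. The choice for letters `a`
of probability `0` is irrelevant. -/
noncomputable def transition (P : stdSimplex ℝ (V × V)) (a : V) : stdSimplex ℝ V :=
  if h : fstMarginal P a = 0 then fstMarginal P else
    ⟨fun b => P (a, b) / fstMarginal P a,
      fun _ => div_nonneg (P.2.1 _) ((fstMarginal P).2.1 a), by
        rw [← Finset.sum_div]; exact div_self h⟩

variable [MeasurableSpace V] [DiscreteMeasurableSpace V]

/-- The measure with given point probabilities. -/
noncomputable def toMeasure {X : Type u} [Fintype X] [MeasurableSpace X]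
    (p : stdSimplex ℝ X) : Measure X :=
  ∑ a, ENNReal.ofReal (p a) • Measure.dirac a

instance toMeasure_isProbabilityMeasure {X : Type u} [Fintype X] [MeasurableSpace X]
    (p : stdSimplex ℝ X) : IsProbabilityMeasure (toMeasure p) :=
  ⟨by
    simp only [toMeasure, Measure.coe_finsetSum, Finset.sum_apply, Measure.smul_apply,
      measure_univ, smul_eq_mul, mul_one]
    rw [← ENNReal.ofReal_sum_of_nonneg (fun a _ => stdSimplex.zero_le p a),
      stdSimplex.sum_eq_one, ENNReal.ofReal_one]⟩

/-- The kernel that draws the letter at time `n + 1` from the past up to time `n`. -/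
noncomputable def stepKernel (P : stdSimplex ℝ (V × V)) (n : ℕ) :
    ProbabilityTheory.Kernel (Finset.Iic n → V) V :=
  (ProbabilityTheory.Kernel.ofFunOfCountable fun a => toMeasure (transition P a)).comap
    (fun x : Finset.Iic n → V => x ⟨n, Finset.mem_Iic.2 le_rfl⟩) (measurable_pi_apply _)

instance stepKernel_isMarkovKernel (P : stdSimplex ℝ (V × V)) (n : ℕ) :
    ProbabilityTheory.IsMarkovKernel (stepKernel P n) :=
  ⟨fun x => toMeasure_isProbabilityMeasure (transition P (x ⟨n, Finset.mem_Iic.2 le_rfl⟩))⟩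

/-- The law on infinite words of the Markov chain with initial distribution `P₁` and
transition probabilities `W`. -/
noncomputable def markovMeasure (P : stdSimplex ℝ (V × V)) : Measure (ℕ → V) :=
  ProbabilityTheory.Kernel.trajMeasure (X := fun _ => V) (toMeasure (fstMarginal P))
    (stepKernel P)

instance markovMeasure_isProbabilityMeasure (P : stdSimplex ℝ (V × V)) :
    IsProbabilityMeasure (markovMeasure P) := by
  unfold markovMeasure; infer_instance

theorem toMeasure_singleton {X : Type u} [Fintype X] [MeasurableSpace X]
    [MeasurableSingletonClass X] (p : stdSimplex ℝ X) (a : X) :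
    toMeasure p {a} = ENNReal.ofReal (p a) := by
  classical
  simp only [toMeasure, Measure.coe_finsetSum, Finset.sum_apply, Measure.smul_apply,
    smul_eq_mul, Measure.dirac_apply]
  rw [Finset.sum_eq_single a]
  · simp
  · intro b _ hb
    simp [hb]
  · simp

/-- The probability of a string `x₀ x₁ … xₙ` is `P₁(x₀) ∏ W(xᵢ₊₁|xᵢ)`. -/
theorem markovMeasure_cylinder (P : stdSimplex ℝ (V × V)) (x : ℕ → V) (n : ℕ) :
    markovMeasure P {ω | ∀ i ≤ n, ω i = x i} = ENNReal.ofReal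
      (fstMarginal P (x 0) * ∏ i ∈ Finset.range n, transition P (x i) (x (i + 1))) := by
  induction n with
  | zero =>
    have h0 : (markovMeasure P).map (Preorder.frestrictLe 0) =
        (toMeasure (fstMarginal P)).map
          (MeasurableEquiv.piUnique fun _ : Finset.Iic 0 => V).symm := by
      rw [markovMeasure, ProbabilityTheory.Kernel.trajMeasure,
        Measure.map_comp _ _ (by fun_prop), ProbabilityTheory.Kernel.traj_map_frestrictLe,
        ProbabilityTheory.Kernel.partialTraj_self, Measure.id_comp]
    have h1 := congrArg (fun ν => ν {fun i : Finset.Iic 0 => x i}) h0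
    beta_reduce at h1
    rw [Measure.map_apply (by fun_prop) (measurableSet_singleton _),
      Measure.map_apply (by fun_prop) (measurableSet_singleton _)] at h1
    have e1 : {ω : ℕ → V | ∀ i ≤ 0, ω i = x i} =
        Preorder.frestrictLe (π := fun _ => V) 0 ⁻¹' {fun i : Finset.Iic 0 => x i} := by
      ext ω
      simp [funext_iff, Preorder.frestrictLe]
    have e2 : (MeasurableEquiv.piUnique fun _ : Finset.Iic 0 => V).symm ⁻¹'
        {fun i : Finset.Iic 0 => x i} = {x 0} := by
      ext a
      simp only [Set.mem_preimage, Set.mem_singleton_iff]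
      rw [MeasurableEquiv.symm_apply_eq]
      rfl
    rw [e1, h1, e2, toMeasure_singleton]
    simp
  | succ n ih =>
    have key := congrArg (fun ν => ν
      ({fun i : Finset.Iic n => x i} ×ˢ {x (n + 1)}))
      (ProbabilityTheory.Kernel.map_frestrictLe_trajMeasure_compProd_eq_map_trajMeasure
        (X := fun _ => V) (μ₀ := toMeasure (fstMarginal P)) (κ := stepKernel P) (a := n))
    beta_reduce at key
    change (((markovMeasure P).map _).compProd _) _ = (markovMeasure P).map _ _ at key
    have hs : MeasurableSet ({fun i : Finset.Iic n => x i} : Set (Finset.Iic n → V)) :=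
      measurableSet_singleton _
    have ht : MeasurableSet ({x (n + 1)} : Set V) := measurableSet_singleton _
    rw [Measure.compProd_apply_prod hs ht, Measure.map_apply (by fun_prop) (hs.prod ht),
      lintegral_singleton, Measure.map_apply (by fun_prop) hs] at key
    have e1 : {ω : ℕ → V | ∀ i ≤ n, ω i = x i} =
        Preorder.frestrictLe (π := fun _ => V) n ⁻¹' {fun i : Finset.Iic n => x i} := by
      ext ω
      simp [funext_iff, Preorder.frestrictLe]
    have e2 : {ω : ℕ → V | ∀ i ≤ n + 1, ω i = x i} =
        (fun ω : ℕ → V => (Preorder.frestrictLe (π := fun _ => V) n ω, ω (n + 1))) ⁻¹'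
          ({fun i : Finset.Iic n => x i} ×ˢ {x (n + 1)}) := by
      ext ω
      simp only [Set.mem_ofPred_eq, Set.mem_preimage, Set.mem_prod, Set.mem_singleton_iff,
        funext_iff, Preorder.frestrictLe_apply, Subtype.forall, Finset.mem_Iic]
      refine ⟨fun h => ⟨fun i hi => h i (by omega), h _ le_rfl⟩, fun h i hi => ?_⟩
      rcases Nat.lt_or_ge n i with h' | h'
      · obtain rfl : i = n + 1 := by omega
        exact h.2
      · exact h.1 i h'
    have e3 : stepKernel P n (fun i : Finset.Iic n => x i) {x (n + 1)} =
        ENNReal.ofReal (transition P (x n) (x (n + 1))) :=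
      toMeasure_singleton (transition P (x n)) (x (n + 1))
    rw [e2, ← key, ← e1, ih, e3, Finset.prod_range_succ, ← mul_assoc, mul_comm,
      ← ENNReal.ofReal_mul']
    exact stdSimplex.zero_le _ _

end Markov

end AmbiguousAlphabet

/-!
The limit and its value come from comparing the source, cut into blocks of a suitable length `k`,
with type classes over the alphabet of blocks.

*The refinement.* On type classes with letter counts `c`, the logarithm of a spectral point is
superadditive in `c` (`logType_add_le`, concatenation) and continuous in `c / n`, uniformly in the
length `n` (`logType_le_add`, fixing a partial word). Fekete's lemma along the counts `⌊n P⌋` gives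
the limit `typeRate f G P`, and all type classes near `n P` have rate close to it
(`exists_abs_logType_sub_le`). So the refinement exists and is `typeRate`.

*The period.* If `k - 1` is a multiple of the lengths of closed walks through all letters, every
transition of the letter chain is also possible in `k` steps. The chain of blocks of length `k` then
has a block that is reached from all others (`exists_reachable_block`), and the letter
frequencies of the block sequence obey a weak law of large numbers: the Poisson equation turns
their deviations into martingales (`tendsto_sum_chainWeight_atypical`).

*Upper bound.* The typical block words form polynomially many type classes near the block law
`μ_k`, so the optimal rate is at most `F(G^k, μ_k) / k`.

*Lower bound.* The probability of a sequence of `m` blocks is at most `C ^ m` times its probability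
under the product distribution `μ_k ^ m`, where `C` bounds the transition probabilities relative to
the stationary distribution. Hence a set of non-negligible probability fills a share of at least
about `C ^ (-m)` of some typical type class (`exists_dense_typeSet`). A type class is
vertex-transitive, so it is covered by correspondingly few translates of that subset
(`le_mul_of_pretransitive`). The optimal rate is therefore at least `F(G^k, μ_k) / k - log C / k`.

As `k` grows, both bounds have the same limit. Since `F(G^n, μ_n)` is monotone in `n`
(`monotone_typeRate_blockLaw`), the admissible `k`, which form an arithmetic progression, determine
the limit of `F(G^n, μ_n) / n` (`exists_tendsto_of_progression`).
-/

namespace AmbiguousAlphabet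

/-! ### Monotonicity and covering bounds for spectral points -/

/-- Two vertices are confusable if they are adjacent or equal. -/
def Confusable {V : Type*} (G : SimpleGraph V) (v w : V) : Prop := v = w ∨ G.Adj v w

theorem confusable_induce {V : Type*} {G : SimpleGraph V} {S : Set V} {v w : S} :
    Confusable (G.induce S) v w ↔ Confusable G v w := by
  simp [Confusable, Subtype.ext_iff]

theorem confusable_strongProduct {V W : Type u} {G : SimpleGraph V} {H : SimpleGraph W}
    {p q : V × W} :
    Confusable (strongProduct G H) p q ↔ Confusable G p.1 q.1 ∧ Confusable H p.2 q.2 := by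
  simp only [Confusable, strongProduct, Prod.ext_iff]
  tauto

/-- A map that reflects confusability is a homomorphism of the complements. -/
theorem cohomLE_of_map {V W : Type u} {H : SimpleGraph W} {G : SimpleGraph V} (φ : W → V)
    (h : ∀ w w', Confusable G (φ w) (φ w') → Confusable H w w') : CohomLE H G :=
  ⟨⟨φ, fun {a b} hab => by
    rw [SimpleGraph.compl_adj] at hab ⊢
    have := h a b
    simp only [Confusable] at this
    tauto⟩⟩

namespace IsSpectralPoint

variable {f : GraphParameter.{u}}

theorem le_of_map (hf : IsSpectralPoint f) {V W : Type u} [Finite V] [Finite W]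
    {H : SimpleGraph W} {G : SimpleGraph V} (φ : W → V)
    (h : ∀ w w', Confusable G (φ w) (φ w') → Confusable H w w') : f W H ≤ f V G :=
  hf.mono V W G H (cohomLE_of_map φ h)

theorem induce_mono (hf : IsSpectralPoint f) {V : Type u} [Finite V] (G : SimpleGraph V)
    {S T : Set V} (h : S ⊆ T) : f S (G.induce S) ≤ f T (G.induce T) :=
  hf.le_of_map (Set.inclusion h) fun _ _ hc => by
    rw [confusable_induce] at hc ⊢
    exact hc

theorem one_le (hf : IsSpectralPoint f) {V : Type u} [Finite V] [Nonempty V]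
    (G : SimpleGraph V) : 1 ≤ f V G := by
  have h := hf.edgeless PUnit.{u + 1}
  rw [Nat.card_unique, Nat.cast_one] at h
  rw [← h]
  exact hf.le_of_map (fun _ => Classical.arbitrary V) fun _ _ _ => Or.inl rfl

theorem le_card (hf : IsSpectralPoint f) {V : Type u} [Finite V] (G : SimpleGraph V) :
    f V G ≤ Nat.card V := by
  rw [← hf.edgeless V]
  refine hf.le_of_map id fun _ _ hc => hc.imp_right fun h => ?_
  exact absurd h (by simp)

theorem induce_union_le (hf : IsSpectralPoint f) {V : Type u} [Finite V] (G : SimpleGraph V)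
    (S T : Set V) :
    f (S ∪ T : Set V) (G.induce (S ∪ T)) ≤ f S (G.induce S) + f T (G.induce T) := by
  classical
  rw [← hf.add]
  refine hf.le_of_map (fun v => if h : v.1 ∈ S then Sum.inl ⟨v.1, h⟩ else
    Sum.inr ⟨v.1, v.2.resolve_left h⟩) fun v w hc => ?_
  rw [confusable_induce]
  by_cases hv : v.1 ∈ S <;> by_cases hw : w.1 ∈ S <;> simp [Confusable, hv, hw] at hc ⊢ <;>
    exact hc

theorem induce_iUnion_le (hf : IsSpectralPoint f) {V : Type u} {ι : Type*} [Finite V]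
    (G : SimpleGraph V) (s : Finset ι) (S : ι → Set V) :
    f (⋃ i ∈ s, S i : Set V) (G.induce (⋃ i ∈ s, S i)) ≤ ∑ i ∈ s, f (S i) (G.induce (S i)) := by
  classical
  induction s using Finset.induction_on with
  | empty =>
    have h := hf.le_card (G.induce (⋃ i ∈ (∅ : Finset ι), S i))
    simpa using h
  | insert a s ha ih =>
    rw [Finset.sum_insert ha]
    refine le_trans ?_ (add_le_add_right ih _)
    refine le_trans (hf.induce_mono G ?_) (hf.induce_union_le G _ _)
    simp

theorem induce_le_card_mul (hf : IsSpectralPoint f) {V : Type u} {ι : Type*} [Finite V]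
    (G : SimpleGraph V) (s : Finset ι) (S : ι → Set V) {T : Set V} {M : ℝ}
    (hT : ∀ v ∈ T, ∃ i ∈ s, v ∈ S i) (hM : ∀ i ∈ s, f (S i) (G.induce (S i)) ≤ M) :
    f T (G.induce T) ≤ s.card * M := by
  refine (hf.induce_mono G (T := ⋃ i ∈ s, S i) fun v hv => ?_).trans
    ((hf.induce_iUnion_le G s S).trans ((Finset.sum_le_sum hM).trans_eq (by simp)))
  simpa using hT v hv

end IsSpectralPoint

/-! ### Covering a vertex-transitive graph by translates of a subset -/

open Classical in
/-- Averaging over a transitive group action: some translate of `S` meets `U` in at least the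
expected proportion. -/
theorem exists_translate_inter_card {Γ X : Type*} [Group Γ] [Fintype Γ] [Fintype X]
    [MulAction Γ X] [MulAction.IsPretransitive Γ X] (S U : Finset X) :
    ∃ g : Γ, S.card * U.card ≤ (U.filter fun x => g • x ∈ S).card * Fintype.card X := by
  rcases isEmpty_or_nonempty X with hX | ⟨⟨x₀⟩⟩
  · exact ⟨1, by simp [Finset.eq_empty_of_isEmpty]⟩
  -- The number of group elements that move `x` to `y` does not depend on `x` and `y`.
  have hconst : ∀ x y : X, (Finset.univ.filter fun g : Γ => g • x = y).card =
      (Finset.univ.filter fun g : Γ => g • x₀ = x₀).card := by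
    intro x y
    obtain ⟨a, ha⟩ := MulAction.exists_smul_eq Γ x₀ x
    obtain ⟨b, hb⟩ := MulAction.exists_smul_eq Γ y x₀
    refine Finset.card_bij' (fun g _ => b * g * a) (fun g _ => b⁻¹ * g * a⁻¹) ?_ ?_ ?_ ?_
    · intro g hg
      simp only [Finset.mem_filter, Finset.mem_univ, true_and] at hg ⊢
      rw [mul_smul, mul_smul, ha, hg, hb]
    · intro g hg
      simp only [Finset.mem_filter, Finset.mem_univ, true_and] at hg ⊢
      rw [mul_smul, mul_smul, ← ha, inv_smul_smul, hg, ← hb, inv_smul_smul]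
    · intro g _; group
    · intro g _; group
  set N := (Finset.univ.filter fun g : Γ => g • x₀ = x₀).card
  have hcount : ∀ (T : Finset X) (x : X),
      (Finset.univ.filter fun g : Γ => g • x ∈ T).card = T.card * N := by
    intro T x
    rw [Finset.card_eq_sum_card_fiberwise (f := fun g : Γ => g • x) (t := T)
      (fun g hg => by simpa using hg), ← smul_eq_mul, ← Finset.sum_const]
    refine Finset.sum_congr rfl fun y hy => ?_
    rw [← hconst x y]
    congr 1
    ext g
    simp only [Finset.mem_filter, Finset.mem_univ, true_and]
    exact ⟨fun h => h.2, fun h => ⟨h ▸ hy, h⟩⟩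
  have hN : Fintype.card Γ = Fintype.card X * N := by
    have := hcount Finset.univ x₀
    simpa using this
  by_contra! hlt
  have hsum : ∑ g : Γ, (U.filter fun x => g • x ∈ S).card = U.card * (S.card * N) := by
    simp only [Finset.card_filter]
    rw [Finset.sum_comm]
    simp only [← Finset.card_filter, hcount, Finset.sum_const, smul_eq_mul]
  have h2 : ∑ g : Γ, (U.filter fun x => g • x ∈ S).card * Fintype.card X <
      ∑ _g : Γ, S.card * U.card :=
    Finset.sum_lt_sum_of_nonempty ⟨1, Finset.mem_univ _⟩ fun g _ => hlt g
  rw [← Finset.sum_mul, hsum, Finset.sum_const, Finset.card_univ, hN, smul_eq_mul] at h2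
  exact absurd h2 (by rw [not_lt]; exact le_of_eq (by ring))

open Classical in
/-- Greedy covering: `N` translates of `S` leave at most a `(1 - |S| / |X|) ^ N` fraction
uncovered. -/
theorem exists_translates_uncovered_card {Γ X : Type*} [Group Γ] [Fintype Γ] [Fintype X]
    [Nonempty X] [MulAction Γ X] [MulAction.IsPretransitive Γ X] (S : Finset X) (N : ℕ) :
    ∃ g : Fin N → Γ, ((Finset.univ.filter fun x => ∀ i, g i • x ∉ S).card : ℝ) ≤
      Fintype.card X * (1 - S.card / Fintype.card X : ℝ) ^ N := by
  have hX : (0 : ℝ) < Fintype.card X := by exact_mod_cast Fintype.card_pos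
  induction N with
  | zero => exact ⟨Fin.elim0, by simp⟩
  | succ N ih =>
    obtain ⟨g, hg⟩ := ih
    set U := Finset.univ.filter fun x : X => ∀ i, g i • x ∉ S
    obtain ⟨a, ha⟩ := exists_translate_inter_card (Γ := Γ) S U
    refine ⟨Fin.cons a g, ?_⟩
    have hU : (Finset.univ.filter fun x : X => ∀ i, (Fin.cons a g : Fin (N + 1) → Γ) i • x ∉ S) =
        U.filter fun x => a • x ∉ S := by
      ext x
      simp [U, Fin.forall_fin_succ, and_comm]
    rw [hU]
    have hsplit : ((U.filter fun x => a • x ∈ S).card : ℝ) +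
        (U.filter fun x => a • x ∉ S).card = U.card := by
      exact_mod_cast Finset.card_filter_add_card_filter_not _
    have ha' : (S.card : ℝ) / Fintype.card X * U.card ≤ (U.filter fun x => a • x ∈ S).card := by
      rw [div_mul_eq_mul_div, div_le_iff₀ hX]
      exact_mod_cast ha
    have hs : (0 : ℝ) ≤ 1 - S.card / Fintype.card X := by
      rw [sub_nonneg, div_le_one hX]
      exact_mod_cast Finset.card_le_univ S
    calc ((U.filter fun x => a • x ∉ S).card : ℝ)
        ≤ (1 - S.card / Fintype.card X) * U.card := by linarith
      _ ≤ (1 - S.card / Fintype.card X) * (Fintype.card X *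
          (1 - S.card / Fintype.card X : ℝ) ^ N) := mul_le_mul_of_nonneg_left hg hs
      _ = _ := by ring

/-- A transitive set is covered by about `log |X| / η` translates of a subset of density
at least `η`; hence a spectral point loses at most that factor on the subset. -/
theorem IsSpectralPoint.le_mul_of_pretransitive {f : GraphParameter.{u}}
    (hf : IsSpectralPoint f) {X : Type u} {Γ : Type*} [Group Γ] [Finite Γ] [Finite X] [Nonempty X]
    [MulAction Γ X] [MulAction.IsPretransitive Γ X] (H : SimpleGraph X)
    (hH : ∀ (g : Γ) x y, Confusable H (g • x) (g • y) ↔ Confusable H x y)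
    (S : Set X) {η : ℝ} (hη : 0 < η) (hS : η * Nat.card X ≤ Nat.card S) :
    f X H ≤ (Real.log (Nat.card X) / η + 1) * f S (H.induce S) := by
  classical
  have := Fintype.ofFinite X
  have := Fintype.ofFinite Γ
  have hX : (0 : ℝ) < Fintype.card X := by exact_mod_cast Fintype.card_pos
  have hX1 : (1 : ℝ) ≤ Fintype.card X := by exact_mod_cast Fintype.card_pos
  rw [Nat.card_eq_fintype_card (α := X)] at *
  have hlog : 0 ≤ Real.log (Fintype.card X) := Real.log_nonneg hX1
  set N := ⌊Real.log (Fintype.card X) / η⌋₊ + 1 with hN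
  obtain ⟨g, hg⟩ := exists_translates_uncovered_card (Γ := Γ) S.toFinset N
  have hdens : η ≤ S.toFinset.card / Fintype.card X := by
    rwa [le_div_iff₀ hX, Set.toFinset_card, ← Nat.card_eq_fintype_card (α := S)]
  have hdens1 : (S.toFinset.card : ℝ) / Fintype.card X ≤ 1 := by
    rw [div_le_one hX]
    exact_mod_cast Finset.card_le_univ _
  have hlt : (Fintype.card X : ℝ) * (1 - S.toFinset.card / Fintype.card X : ℝ) ^ N < 1 := by
    have h1 : (1 - S.toFinset.card / Fintype.card X : ℝ) ^ N ≤ Real.exp (-η) ^ N := by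
      refine pow_le_pow_left₀ (by linarith) ?_ _
      have := Real.add_one_le_exp (-η)
      linarith
    have h2 : Real.log (Fintype.card X) < N * η := by
      rw [← div_lt_iff₀ hη, hN]
      push_cast
      exact Nat.lt_floor_add_one _
    calc (Fintype.card X : ℝ) * (1 - S.toFinset.card / Fintype.card X : ℝ) ^ N
        ≤ Real.exp (Real.log (Fintype.card X)) * Real.exp (-η) ^ N := by
          rw [Real.exp_log hX]
          exact mul_le_mul_of_nonneg_left h1 hX.le
      _ = Real.exp (Real.log (Fintype.card X) - N * η) := by
          rw [← Real.exp_nat_mul, ← Real.exp_add]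
          congr 1
          ring
      _ < 1 := by
          rw [Real.exp_lt_one_iff]
          linarith
  have hcov : ∀ x, ∃ i, g i • x ∈ S := by
    intro x
    have h0 : (Finset.univ.filter fun x => ∀ i, g i • x ∉ S.toFinset).card = 0 := by
      have := hg.trans_lt hlt
      exact_mod_cast Nat.lt_one_iff.1 (by exact_mod_cast this)
    rw [Finset.card_eq_zero, Finset.filter_eq_empty_iff] at h0
    simpa using h0 (Finset.mem_univ x)
  have h1 := hf.induce_le_card_mul H (Finset.univ : Finset (Fin N))
    (fun i => {x | g i • x ∈ S}) (T := Set.univ) (M := f S (H.induce S))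
    (fun x _ => by simpa using hcov x) (fun i _ => by
      refine hf.le_of_map (fun x => ⟨g i • x.1, x.2⟩) fun x y hc => ?_
      rw [confusable_induce] at hc ⊢
      exact (hH _ _ _).1 hc)
  have h2 : f X H ≤ f (Set.univ : Set X) (H.induce Set.univ) :=
    hf.le_of_map (fun x => ⟨x, Set.mem_univ x⟩) fun x y hc => by
      rwa [confusable_induce] at hc
  refine h2.trans (h1.trans (mul_le_mul_of_nonneg_right ?_ (hf.nonneg _ _)))
  rw [Finset.card_univ, Fintype.card_fin, hN]
  push_cast
  have := Nat.floor_le (div_nonneg hlog hη.le)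
  linarith

/-! ### Type classes with integer letter counts -/

/-- The strong power of a graph with an arbitrary index set for the coordinates. -/
def powerGraph {V : Type*} (G : SimpleGraph V) (ι : Type*) : SimpleGraph (ι → V) where
  Adj x y := x ≠ y ∧ ∀ i, x i = y i ∨ G.Adj (x i) (y i)
  symm := ⟨fun _ _ h => ⟨h.1.symm, fun i => (h.2 i).imp Eq.symm fun e => e.symm⟩⟩
  loopless := ⟨fun _ h => h.1 rfl⟩

theorem confusable_powerGraph {V ι : Type*} {G : SimpleGraph V} {x y : ι → V} :
    Confusable (powerGraph G ι) x y ↔ ∀ i, Confusable G (x i) (y i) := by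
  simp only [Confusable, powerGraph]
  constructor
  · rintro (rfl | h) i
    · exact Or.inl rfl
    · exact h.2 i
  · intro h
    by_cases hxy : x = y
    · exact Or.inl hxy
    · exact Or.inr ⟨hxy, h⟩

theorem confusable_strongPower {V : Type u} {n : ℕ} {G : SimpleGraph V} {x y : Fin n → V} :
    Confusable (strongPower G n) x y ↔ ∀ i, Confusable G (x i) (y i) :=
  confusable_powerGraph

/-- The number of occurrences of a letter in a word. -/
noncomputable def letterCount {V ι : Type*} (x : ι → V) (a : V) : ℕ := Nat.card {i // x i = a}

/-- The words with prescribed letter counts. -/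
def typeSet {V : Type*} (ι : Type*) (c : V → ℕ) : Set (ι → V) := {x | ∀ a, letterCount x a = c a}

theorem letterCount_comp_equiv {V ι κ : Type*} (e : κ ≃ ι) (x : ι → V) (a : V) :
    letterCount (x ∘ e) a = letterCount x a :=
  Nat.card_congr (e.subtypeEquiv fun _ => Iff.rfl)

theorem letterCount_sumElim {V ι κ : Type*} [Finite ι] [Finite κ] (x : ι → V) (y : κ → V)
    (a : V) : letterCount (Sum.elim x y) a = letterCount x a + letterCount y a := by
  rw [letterCount, Nat.card_congr Equiv.subtypeSum, Nat.card_sum]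
  rfl

theorem sum_letterCount {V ι : Type*} [Fintype V] [Finite ι] (x : ι → V) :
    ∑ a, letterCount x a = Nat.card ι := by
  rw [← Nat.card_congr (Equiv.sigmaFiberEquiv x), Nat.card_sigma]
  rfl

theorem letterCount_le {V ι : Type*} [Finite ι] (x : ι → V) (a : V) :
    letterCount x a ≤ Nat.card ι :=
  Finite.card_subtype_le _

theorem typeSet_nonempty {V ι : Type*} [Fintype V] [Finite ι] {c : V → ℕ}
    (h : Nat.card ι = ∑ a, c a) : (typeSet ι c).Nonempty := by
  have hcard : Nat.card ι = Nat.card (Σ a, Fin (c a)) := by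
    rw [h, Nat.card_sigma]
    simp
  have e : ι ≃ Σ a, Fin (c a) := (Finite.card_eq.1 hcard).some
  refine ⟨(Sigma.fst : (Σ a, Fin (c a)) → V) ∘ e, fun a => ?_⟩
  rw [letterCount_comp_equiv, letterCount, Nat.card_congr (Equiv.sigmaSubtype a)]
  simp

/-- The value of a graph parameter on a type class. -/
noncomputable def typeValue (f : GraphParameter.{u}) {V : Type u} [Finite V] (G : SimpleGraph V)
    (ι : Type) [Finite ι] (c : V → ℕ) : ℝ :=
  f (typeSet ι c) ((powerGraph G ι).induce (typeSet ι c))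

namespace IsSpectralPoint

variable {f : GraphParameter.{u}}

theorem typeValue_le_of_equiv (hf : IsSpectralPoint f) {V : Type u} [Finite V]
    (G : SimpleGraph V) {ι κ : Type} [Finite ι] [Finite κ] (e : κ ≃ ι) (c : V → ℕ) :
    typeValue f G ι c ≤ typeValue f G κ c := by
  refine hf.le_of_map (fun x => ⟨x.1 ∘ e, fun a => ?_⟩) fun x y hc => ?_
  · rw [letterCount_comp_equiv]
    exact x.2 a
  · simp only [confusable_induce, confusable_powerGraph, Function.comp] at hc ⊢
    intro i
    simpa using hc (e.symm i)

theorem typeValue_congr (hf : IsSpectralPoint f) {V : Type u} [Finite V]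
    (G : SimpleGraph V) {ι κ : Type} [Finite ι] [Finite κ] (h : Nat.card ι = Nat.card κ)
    (c : V → ℕ) : typeValue f G ι c = typeValue f G κ c := by
  have e : ι ≃ κ := (Finite.card_eq.1 h).some
  exact le_antisymm (hf.typeValue_le_of_equiv G e.symm c) (hf.typeValue_le_of_equiv G e c)

theorem one_le_typeValue (hf : IsSpectralPoint f) {V : Type u} [Fintype V]
    (G : SimpleGraph V) {ι : Type} [Finite ι] {c : V → ℕ} (h : Nat.card ι = ∑ a, c a) :
    1 ≤ typeValue f G ι c := by
  have := (typeSet_nonempty h).to_subtype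
  exact hf.one_le _

theorem typeValue_le_pow (hf : IsSpectralPoint f) {V : Type u} [Finite V]
    (G : SimpleGraph V) (ι : Type) [Finite ι] (c : V → ℕ) :
    typeValue f G ι c ≤ (Nat.card V : ℝ) ^ Nat.card ι := by
  refine (hf.le_card _).trans ?_
  rw [← Nat.cast_pow, ← Nat.card_fun]
  exact_mod_cast Finite.card_subtype_le _

/-- Concatenation embeds a product of type classes into a type class. -/
theorem typeValue_mul_le (hf : IsSpectralPoint f) {V : Type u} [Finite V]
    (G : SimpleGraph V) (ι κ : Type) [Finite ι] [Finite κ] (c d : V → ℕ) :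
    typeValue f G ι c * typeValue f G κ d ≤ typeValue f G (ι ⊕ κ) (c + d) := by
  rw [typeValue, typeValue, ← hf.mul]
  refine hf.le_of_map (fun p => ⟨Sum.elim p.1.1 p.2.1, fun a => ?_⟩) fun p q hc => ?_
  · rw [letterCount_sumElim, p.1.2 a, p.2.2 a]
    rfl
  · simp only [confusable_strongProduct, confusable_induce, confusable_powerGraph] at hc ⊢
    exact ⟨fun i => hc (Sum.inl i), fun i => hc (Sum.inr i)⟩

end IsSpectralPoint

/-- Some letters of a word with counts `c + d` can be singled out so that they have counts `d`;
`none` marks the remaining positions. -/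
theorem exists_partial_word {V ι : Type*} [Finite ι] {c d : V → ℕ} {u : ι → V}
    (hu : u ∈ typeSet ι (c + d)) :
    ∃ z : ι → Option V, (∀ a, letterCount z (some a) = d a) ∧
      ∀ i a, z i = some a → u i = a := by
  classical
  have := Fintype.ofFinite ι
  have h : ∀ a, ∃ A ⊆ Finset.univ.filter fun i => u i = a, A.card = d a := by
    intro a
    refine Finset.exists_subset_card_eq ?_
    have := hu a
    rw [letterCount, Nat.card_eq_fintype_card, Fintype.card_subtype] at this
    rw [this]
    exact Nat.le_add_left _ _
  choose A hA hAc using h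
  have hA' : ∀ a i, i ∈ A a → u i = a := fun a i hi => by simpa using hA a hi
  refine ⟨fun i => if i ∈ A (u i) then some (u i) else none, fun a => ?_, fun i a h => ?_⟩
  · rw [← hAc a, letterCount, Nat.card_eq_fintype_card, Fintype.card_subtype]
    congr 1
    ext i
    simp only [Finset.mem_filter, Finset.mem_univ, true_and, ite_eq_iff, Option.some_inj,
      reduceCtorEq, and_false, or_false]
    exact ⟨fun h => h.2 ▸ h.1, fun h => ⟨(hA' a i h).symm ▸ h, hA' a i h⟩⟩
  · simp only [ite_eq_iff, Option.some_inj, reduceCtorEq, and_false, or_false] at h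
    exact h.2

/-- The number of words over `Option V` with `j` letters in `V`, by a generating function. -/
theorem card_partial_words_mul_pow_le {V ι : Type*} [Fintype V] [Fintype ι]
    (s : Finset (ι → Option V)) {j : ℕ} {x : ℝ} (hx : 0 ≤ x)
    (hs : ∀ z ∈ s, ∑ a, letterCount z (some a) = j) :
    s.card * x ^ j ≤ (1 + Fintype.card V * x) ^ Fintype.card ι := by
  classical
  have h1 : ∏ _i : ι, ∑ o : Option V, (o.elim 1 fun _ => x : ℝ) =
      ∑ z : ι → Option V, ∏ i, ((z i).elim 1 fun _ => x : ℝ) := by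
    rw [Finset.prod_univ_sum, Fintype.piFinset_univ]
  have h2 : ∏ _i : ι, ∑ o : Option V, (o.elim 1 fun _ => x : ℝ) =
      (1 + Fintype.card V * x) ^ Fintype.card ι := by
    simp [Fintype.sum_option]
  rw [← h2, h1, ← nsmul_eq_mul, ← Finset.sum_const]
  refine (Finset.sum_le_sum fun z hz => ?_).trans
    (Finset.sum_le_sum_of_subset_of_nonneg (Finset.subset_univ s) fun z _ _ => ?_)
  · have h3 : (Finset.univ.filter fun i => z i ≠ none).card = j := by
      rw [← hs z hz, Finset.card_eq_sum_card_fiberwise (f := z)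
        (t := Finset.univ.map Function.Embedding.some), Finset.sum_map]
      · refine Finset.sum_congr rfl fun a _ => ?_
        rw [letterCount, Nat.card_eq_fintype_card, Fintype.card_subtype]
        congr 1
        ext i
        simp only [Finset.mem_filter, Finset.mem_univ, true_and, Function.Embedding.some_apply]
        exact ⟨fun h => h.2, fun h => ⟨by simp [h], h⟩⟩
      · intro i hi
        have hi' : z i ≠ none := by simpa using hi
        obtain ⟨a, ha⟩ := Option.ne_none_iff_exists'.1 hi'
        simp [ha]
    refine le_of_eq ?_
    rw [← h3, ← Finset.prod_const, Finset.prod_filter]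
    refine Finset.prod_congr rfl fun i _ => ?_
    cases z i <;> simp
  · refine Finset.prod_nonneg fun i _ => ?_
    cases z i <;> simp [hx]

theorem sum_typeSet {V ι : Type*} [Fintype V] [Finite ι] {c : V → ℕ} {x : ι → V}
    (hx : x ∈ typeSet ι c) : ∑ a, c a = Nat.card ι := by
  rw [← sum_letterCount x]
  exact Finset.sum_congr rfl fun a _ => (hx a).symm

namespace IsSpectralPoint

variable {f : GraphParameter.{u}}

/-- Adding the letters `d` to a type class multiplies `f` by at most the number of partial words
with letter counts `d`: fixing a partial word leaves a type class with counts `c`. -/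
theorem typeValue_add_mul_pow_le (hf : IsSpectralPoint f) {V : Type u} [Fintype V]
    (G : SimpleGraph V) {ι κ : Type} [Finite ι] [Finite κ] {c d : V → ℕ} {x : ℝ} (hx : 0 ≤ x)
    (hκ : Nat.card κ = ∑ a, c a) :
    typeValue f G ι (c + d) * x ^ (∑ a, d a) ≤
      (1 + Fintype.card V * x) ^ Nat.card ι * typeValue f G κ c := by
  classical
  have := Fintype.ofFinite ι
  set s : Finset (ι → Option V) := Finset.univ.filter fun z => ∀ a, letterCount z (some a) = d a
  have hsum : ∀ z ∈ s, ∑ a, letterCount z (some a) = ∑ a, d a := fun z hz =>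
    Finset.sum_congr rfl fun a _ => (Finset.mem_filter.1 hz).2 a
  have h1 : typeValue f G ι (c + d) ≤ s.card * typeValue f G κ c := by
    refine hf.induce_le_card_mul (powerGraph G ι) s
      (fun z => {u | u ∈ typeSet ι (c + d) ∧ ∀ i a, z i = some a → u i = a}) ?_ ?_
    · intro u hu
      obtain ⟨z, hz, hz'⟩ := exists_partial_word hu
      exact ⟨z, by simpa [s] using hz, hu, hz'⟩
    · intro z hz
      have hz' : ∀ a, letterCount z (some a) = d a := (Finset.mem_filter.1 hz).2
      -- The letters outside the partial word `z` have counts `c`.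
      have hcount : ∀ u : ι → V, u ∈ typeSet ι (c + d) → (∀ i a, z i = some a → u i = a) →
          (fun i : {i // z i = none} => u i) ∈ typeSet {i // z i = none} c := by
        intro u hu huz a
        have e1 : letterCount u a = letterCount z (some a) +
            letterCount (fun i : {i // z i = none} => u i) a := by
          simp only [letterCount, Nat.card_eq_fintype_card]
          rw [Fintype.card_congr (Equiv.subtypeSubtypeEquivSubtypeInter (fun i => z i = none)
            (fun i => u i = a)), Fintype.card_subtype, Fintype.card_subtype,
            Fintype.card_subtype, ← Finset.card_union_of_disjoint]
          · congr 1
            ext i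
            simp only [Finset.mem_union, Finset.mem_filter, Finset.mem_univ, true_and]
            constructor
            · intro h
              cases hzi : z i with
              | none => exact Or.inr ⟨rfl, h⟩
              | some b =>
                left
                rw [← h, huz i b hzi]
            · rintro (h | h)
              · exact huz i a h
              · exact h.2
          · rw [Finset.disjoint_left]
            intro i hi hi'
            simp only [Finset.mem_filter, Finset.mem_univ, true_and] at hi hi'
            rw [hi] at hi'
            simp at hi'
        have e2 := hu a
        rw [e1, hz' a, Pi.add_apply] at e2
        omega
      rcases Set.eq_empty_or_nonempty
        {u | u ∈ typeSet ι (c + d) ∧ ∀ i a, z i = some a → u i = a} with he | ⟨u₀, hu₀⟩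
      · refine le_trans (hf.le_card _) ?_
        rw [he]
        simpa [typeValue] using hf.nonneg _ _
      · have hcard : Nat.card {i // z i = none} = Nat.card κ := by
          rw [hκ, sum_typeSet (hcount u₀ hu₀.1 hu₀.2)]
        rw [← hf.typeValue_congr G hcard]
        refine hf.le_of_map (fun u => ⟨fun i => u.1 i, hcount u.1 u.2.1 u.2.2⟩)
          fun u v hc => ?_
        simp only [confusable_induce, confusable_powerGraph] at hc ⊢
        intro i
        cases hzi : z i with
        | none => exact hc ⟨i, hzi⟩
        | some b => exact Or.inl ((u.2.2 i b hzi).trans (v.2.2 i b hzi).symm)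
  have h2 := card_partial_words_mul_pow_le s hx hsum
  rw [← Nat.card_eq_fintype_card (α := ι)] at h2
  calc typeValue f G ι (c + d) * x ^ (∑ a, d a)
      ≤ s.card * typeValue f G κ c * x ^ (∑ a, d a) :=
        mul_le_mul_of_nonneg_right h1 (pow_nonneg hx _)
    _ = s.card * x ^ (∑ a, d a) * typeValue f G κ c := by ring
    _ ≤ _ := mul_le_mul_of_nonneg_right h2 (hf.nonneg _ _)

end IsSpectralPoint

/-! ### Existence and uniqueness of the probabilistic refinement -/

/-- The logarithm of the value of a graph parameter on the type class with given letter counts. -/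
noncomputable def logType (f : GraphParameter.{u}) {V : Type u} [Fintype V] (G : SimpleGraph V)
    (c : V → ℕ) : ℝ :=
  Real.logb 2 (typeValue f G (Fin (∑ a, c a)) c)

namespace IsSpectralPoint

variable {f : GraphParameter.{u}}

theorem logb_typeValue (hf : IsSpectralPoint f) {V : Type u} [Fintype V] (G : SimpleGraph V)
    {ι : Type} [Finite ι] {c : V → ℕ} (h : Nat.card ι = ∑ a, c a) :
    Real.logb 2 (typeValue f G ι c) = logType f G c := by
  rw [logType, hf.typeValue_congr G (κ := Fin (∑ a, c a)) (by simpa using h)]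

theorem logType_nonneg (hf : IsSpectralPoint f) {V : Type u} [Fintype V] (G : SimpleGraph V)
    (c : V → ℕ) : 0 ≤ logType f G c :=
  Real.logb_nonneg one_lt_two (hf.one_le_typeValue G (by simp))

theorem typeValue_pos (hf : IsSpectralPoint f) {V : Type u} [Fintype V] (G : SimpleGraph V)
    {ι : Type} [Finite ι] {c : V → ℕ} (h : Nat.card ι = ∑ a, c a) : 0 < typeValue f G ι c :=
  zero_lt_one.trans_le (hf.one_le_typeValue G h)

theorem logType_le (hf : IsSpectralPoint f) {V : Type u} [Fintype V] (G : SimpleGraph V)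
    (c : V → ℕ) : logType f G c ≤ (∑ a, c a : ℕ) * Real.logb 2 (Nat.card V) := by
  rw [← Real.logb_pow]
  refine Real.logb_le_logb_of_le one_lt_two (hf.typeValue_pos G (by simp)) ?_
  refine (hf.typeValue_le_pow G _ c).trans_eq ?_
  rw [Nat.card_fin]

theorem logType_add_le (hf : IsSpectralPoint f) {V : Type u} [Fintype V] (G : SimpleGraph V)
    (c d : V → ℕ) : logType f G c + logType f G d ≤ logType f G (c + d) := by
  have hc := hf.typeValue_pos G (ι := Fin (∑ a, c a)) (c := c) (by simp)
  have hd := hf.typeValue_pos G (ι := Fin (∑ a, d a)) (c := d) (by simp)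
  rw [← hf.logb_typeValue G (ι := Fin (∑ a, c a) ⊕ Fin (∑ a, d a)) (c := c + d)
    (by simp [Finset.sum_add_distrib]), logType, logType, ← Real.logb_mul hc.ne' hd.ne']
  exact Real.logb_le_logb_of_le one_lt_two (mul_pos hc hd) (hf.typeValue_mul_le G _ _ c d)

theorem logType_mono (hf : IsSpectralPoint f) {V : Type u} [Fintype V] (G : SimpleGraph V)
    {c d : V → ℕ} (h : c ≤ d) : logType f G c ≤ logType f G d := by
  have h1 := hf.logType_add_le G c (d - c)
  rw [add_tsub_cancel_of_le h] at h1
  linarith [hf.logType_nonneg G (d - c)]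

/-- Continuity of `logType` in the letter counts; the parameter `x` is free and is chosen
small first, so that the first error term is a small multiple of the length. -/
theorem logType_le_add (hf : IsSpectralPoint f) {V : Type u} [Fintype V] (G : SimpleGraph V)
    (c d : V → ℕ) {x : ℝ} (hx : 0 < x) (hx1 : x ≤ 1) :
    logType f G c ≤ logType f G d + (∑ a, c a : ℕ) * Real.logb 2 (1 + Fintype.card V * x) +
      (∑ a, |(c a : ℝ) - d a|) * -Real.logb 2 x := by
  have hcd : c ⊓ d + (c - d) = c := by
    ext a
    simp only [Pi.add_apply, Pi.inf_apply, Pi.sub_apply]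
    omega
  have hpos1 : (0 : ℝ) < 1 + Fintype.card V * x := by positivity
  have he := hf.typeValue_pos G (ι := Fin (∑ a, (c ⊓ d) a)) (c := c ⊓ d) (by simp)
  have hc := hf.typeValue_pos G (ι := Fin (∑ a, c a)) (c := c) (by simp)
  have h1 := hf.typeValue_add_mul_pow_le G (ι := Fin (∑ a, c a))
    (κ := Fin (∑ a, (c ⊓ d) a)) (c := c ⊓ d) (d := c - d) hx.le
    (by simp)
  rw [hcd] at h1
  have h2 := Real.logb_le_logb_of_le one_lt_two (mul_pos hc (pow_pos hx _)) h1
  rw [Real.logb_mul hc.ne' (pow_pos hx _).ne', Real.logb_mul (pow_pos hpos1 _).ne' he.ne',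
    Real.logb_pow, Real.logb_pow, Nat.card_fin] at h2
  have h3 : ((∑ a, (c - d) a : ℕ) : ℝ) ≤ ∑ a, |(c a : ℝ) - d a| := by
    rw [Nat.cast_sum]
    refine Finset.sum_le_sum fun a _ => ?_
    rw [Pi.sub_apply]
    rcases le_total (c a) (d a) with h | h
    · rw [Nat.sub_eq_zero_of_le h]
      simp
    · rw [Nat.cast_sub h]
      exact le_abs_self _
  have h4 : 0 ≤ -Real.logb 2 x := by
    rw [neg_nonneg]
    exact Real.logb_nonpos one_lt_two hx.le hx1
  have h5 := mul_le_mul_of_nonneg_right h3 h4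
  have h6 := hf.logType_mono G (inf_le_right : c ⊓ d ≤ d)
  change _ + _ ≤ _ + logType f G (c ⊓ d) at h2
  change logType f G c + _ ≤ _ at h2
  linarith

end IsSpectralPoint

theorem exists_tendsto_div_of_superadditive {t : ℕ → ℝ} {B : ℝ}
    (ht : ∀ m n, t m + t n ≤ t (m + n)) (hB : ∀ n : ℕ, t n ≤ n * B) (hB0 : 0 ≤ B) :
    ∃ r : ℝ, Tendsto (fun n : ℕ => t n / n) atTop (𝓝 r) := by
  have hsub : Subadditive fun n => -t n := fun m n => by
    have := ht m n
    simp only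
    linarith
  have hbdd : BddBelow (Set.range fun n : ℕ => -t n / n) := by
    refine ⟨-B, ?_⟩
    rintro _ ⟨n, rfl⟩
    rcases Nat.eq_zero_or_pos n with rfl | hn
    · simpa using hB0
    · have hn' : (0 : ℝ) < n := by exact_mod_cast hn
      simp only
      rw [le_div_iff₀ hn', neg_mul, neg_le_neg_iff, mul_comm]
      exact hB n
  exact ⟨-hsub.lim, (hsub.tendsto_lim hbdd).neg.congr fun n => by rw [neg_div, neg_neg]⟩

/-- The limit of `logType / n` along the letter counts `⌊n P⌋`. -/
noncomputable def typeRate (f : GraphParameter.{u}) {V : Type u} [Fintype V] (G : SimpleGraph V)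
    (P : V → ℝ) : ℝ :=
  limUnder atTop fun n : ℕ => logType f G (fun a => ⌊n * P a⌋₊) / n

namespace IsSpectralPoint

variable {f : GraphParameter.{u}}

/-- Rounding down makes the letter counts superadditive in the length, so Fekete's lemma
applies. -/
theorem tendsto_typeRate (hf : IsSpectralPoint f) {V : Type u} [Fintype V] (G : SimpleGraph V)
    {P : V → ℝ} (hP : P ∈ stdSimplex ℝ V) :
    Tendsto (fun n : ℕ => logType f G (fun a => ⌊n * P a⌋₊) / n) atTop (𝓝 (typeRate f G P)) := by
  have hlog : 0 ≤ Real.logb 2 (Nat.card V) := by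
    rcases Nat.eq_zero_or_pos (Nat.card V) with h | h
    · rw [h]
      simp
    · exact Real.logb_nonneg one_lt_two (by exact_mod_cast h)
  refine tendsto_nhds_limUnder (exists_tendsto_div_of_superadditive
    (t := fun n : ℕ => logType f G (fun a => ⌊n * P a⌋₊)) (B := Real.logb 2 (Nat.card V))
    (fun m n => ?_) (fun n => ?_) hlog)
  · have h1 := hf.logType_add_le G (fun a => ⌊m * P a⌋₊) (fun a => ⌊n * P a⌋₊)
    have h2 : (fun a => ⌊m * P a⌋₊) + (fun a => ⌊n * P a⌋₊) ≤
        fun a => ⌊((m + n : ℕ) : ℝ) * P a⌋₊ := by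
      intro a
      rw [Pi.add_apply]
      refine Nat.le_floor ?_
      push_cast
      rw [add_mul]
      exact add_le_add (Nat.floor_le (mul_nonneg (Nat.cast_nonneg _) (hP.1 a)))
        (Nat.floor_le (mul_nonneg (Nat.cast_nonneg _) (hP.1 a)))
    exact h1.trans (hf.logType_mono G h2)
  · refine (hf.logType_le G _).trans (mul_le_mul_of_nonneg_right ?_ hlog)
    have h1 : ∑ a, (n : ℝ) * P a = n := by rw [← Finset.mul_sum, hP.2, mul_one]
    rw [Nat.cast_sum]
    calc ∑ a, (⌊(n : ℝ) * P a⌋₊ : ℝ) ≤ ∑ a, (n : ℝ) * P a := Finset.sum_le_sum fun a _ =>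
          Nat.floor_le (mul_nonneg (Nat.cast_nonneg _) (hP.1 a))
      _ = n := h1

/-- Uniform approximation: all type classes with letter counts close to `n P` have a value
close to the rate at `P`. -/
theorem exists_abs_logType_sub_le (hf : IsSpectralPoint f) {V : Type u} [Fintype V]
    (G : SimpleGraph V) {P : V → ℝ} (hP : P ∈ stdSimplex ℝ V) {ε : ℝ} (hε : 0 < ε) :
    ∃ δ > 0, ∃ N : ℕ, ∀ n ≥ N, ∀ c : V → ℕ, ∑ a, c a = n →
      (∀ a, |(c a : ℝ) - n * P a| ≤ δ * n) → |logType f G c - n * typeRate f G P| ≤ ε * n := by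
  set K : ℝ := (Fintype.card V : ℝ) with hK
  have hK0 : 0 ≤ K := Nat.cast_nonneg _
  obtain ⟨x, hx, hx1, hxε⟩ : ∃ x : ℝ, 0 < x ∧ x ≤ 1 ∧ Real.logb 2 (1 + K * x) ≤ ε / 4 := by
    have hcont : Tendsto (fun x : ℝ => Real.logb 2 (1 + K * x)) (𝓝[>] 0) (𝓝 0) := by
      have h0 : ContinuousAt (fun x : ℝ => Real.logb 2 (1 + K * x)) 0 := by
        unfold Real.logb
        refine ContinuousAt.div_const (ContinuousAt.log (by fun_prop) (by simp)) _
      have h1 := h0.tendsto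
      simp only [mul_zero, add_zero, Real.logb_one] at h1
      exact h1.mono_left nhdsWithin_le_nhds
    have h2 : ∀ᶠ x in 𝓝[>] (0 : ℝ), Real.logb 2 (1 + K * x) < ε / 4 :=
      hcont.eventually_lt_const (by positivity)
    have h3 : ∀ᶠ x in 𝓝[>] (0 : ℝ), x ∈ Set.Ioo (0 : ℝ) 1 := Ioo_mem_nhdsGT one_pos
    obtain ⟨x, hx, hx'⟩ := (h2.and h3).exists
    exact ⟨x, hx'.1, hx'.2.le, hx.le⟩
  set A : ℝ := -Real.logb 2 x with hA
  have hA0 : 0 ≤ A := by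
    rw [hA, neg_nonneg]
    exact Real.logb_nonpos one_lt_two hx.le hx1
  have hev : ∀ᶠ n : ℕ in atTop,
      |logType f G (fun a => ⌊n * P a⌋₊) / n - typeRate f G P| < ε / 4 ∧
        K * A ≤ ε / 4 * n ∧ 0 < n := by
    refine Eventually.and ?_ (Eventually.and ?_ (eventually_gt_atTop 0))
    · have := (hf.tendsto_typeRate G hP).eventually (Metric.ball_mem_nhds _ (half_pos
        (half_pos hε)))
      filter_upwards [this] with n hn
      rw [Real.dist_eq] at hn
      linarith
    · have : Tendsto (fun n : ℕ => ε / 4 * (n : ℝ)) atTop atTop :=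
        tendsto_natCast_atTop_atTop.const_mul_atTop (by positivity)
      exact this.eventually_ge_atTop _
  obtain ⟨N, hN⟩ := eventually_atTop.1 hev
  refine ⟨ε / (4 * (K * A + 1)), by positivity, N, fun n hn c hc hcP => ?_⟩
  obtain ⟨h1, h2, h3⟩ := hN n hn
  have hn0 : (0 : ℝ) < n := by exact_mod_cast h3
  set r : V → ℕ := fun a => ⌊n * P a⌋₊ with hr
  have hr1 : ∀ a, (r a : ℝ) ≤ n * P a := fun a =>
    Nat.floor_le (mul_nonneg (Nat.cast_nonneg _) (hP.1 a))
  have hr2 : ∀ a, n * P a ≤ r a + 1 := fun a => (Nat.lt_floor_add_one _).le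
  have hrn : ((∑ a, r a : ℕ) : ℝ) ≤ n := by
    rw [Nat.cast_sum]
    refine (Finset.sum_le_sum fun a _ => hr1 a).trans_eq ?_
    rw [← Finset.mul_sum, hP.2, mul_one]
  set δ := ε / (4 * (K * A + 1)) with hδ
  have hdist : ∑ a, |(c a : ℝ) - r a| ≤ K * (δ * n + 1) := by
    have : ∀ a, |(c a : ℝ) - r a| ≤ δ * n + 1 := fun a => by
      have h4 := abs_le.1 (hcP a)
      rw [abs_le]
      constructor <;> linarith [hr1 a, hr2 a]
    refine (Finset.sum_le_sum fun a _ => this a).trans_eq ?_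
    rw [Finset.sum_const, Finset.card_univ, nsmul_eq_mul]
  have hdist' : (∑ a, |(c a : ℝ) - r a|) * A ≤ ε / 2 * n := by
    refine (mul_le_mul_of_nonneg_right hdist hA0).trans ?_
    have h5 : δ * (K * A) ≤ ε / 4 := by
      rw [hδ, div_mul_eq_mul_div, div_le_div_iff₀ (by positivity) (by norm_num)]
      nlinarith [mul_nonneg hK0 hA0]
    nlinarith
  have hlog0 : 0 ≤ Real.logb 2 (1 + K * x) :=
    Real.logb_nonneg one_lt_two (by nlinarith [mul_nonneg hK0 hx.le])
  have h6 := hf.logType_le_add G c r hx hx1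
  have h7 := hf.logType_le_add G r c hx hx1
  simp only [abs_sub_comm (r _ : ℝ)] at h7
  rw [← hK, ← hA] at h6 h7
  rw [hc] at h6
  have h8 : (n : ℝ) * Real.logb 2 (1 + K * x) ≤ ε / 4 * n := by nlinarith
  have h9 : ((∑ a, r a : ℕ) : ℝ) * Real.logb 2 (1 + K * x) ≤ ε / 4 * n :=
    (mul_le_mul_of_nonneg_right hrn hlog0).trans h8
  have h10 : |logType f G r - n * typeRate f G P| ≤ ε / 4 * n := by
    have h11 : logType f G r - n * typeRate f G P =
        (logType f G r / n - typeRate f G P) * n := by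
      field_simp
    rw [h11, abs_mul, abs_of_pos hn0]
    exact mul_le_mul_of_nonneg_right h1.le hn0.le
  rw [abs_le] at h10 ⊢
  constructor <;> linarith [h10.1, h10.2]

end IsSpectralPoint

theorem typeClass_eq_typeSet {V : Type u} [Fintype V] {n : ℕ} {Q : stdSimplex ℝ V} {c : V → ℕ}
    (h : ∀ a, (n : ℝ) * Q a = c a) : typeClass n Q = typeSet (Fin n) c := by
  classical
  ext x
  simp only [typeClass, typeSet, Set.mem_ofPred_eq, h]
  refine forall_congr' fun a => ?_
  rw [letterCount, Nat.card_eq_fintype_card, Fintype.card_subtype, Nat.cast_inj]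

theorem value_typeGraph (f : GraphParameter.{u}) {V : Type u} [Fintype V] (G : SimpleGraph V)
    {n : ℕ} {Q : stdSimplex ℝ V} {c : V → ℕ} (h : ∀ a, (n : ℝ) * Q a = c a) :
    f _ (typeGraph G n Q) = typeValue f G (Fin n) c := by
  have key : ∀ S : Set (Fin n → V), S = typeSet (Fin n) c →
      f S ((strongPower G n).induce S) = typeValue f G (Fin n) c := by
    rintro S rfl
    rfl
  exact key _ (typeClass_eq_typeSet h)

theorem sum_of_nType {V : Type u} [Fintype V] {n : ℕ} {Q : stdSimplex ℝ V} {c : V → ℕ}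
    (h : ∀ a, (n : ℝ) * Q a = c a) : ∑ a, c a = n := by
  have : ((∑ a, c a : ℕ) : ℝ) = n := by
    rw [Nat.cast_sum, ← Finset.sum_congr rfl fun a _ => h a, ← Finset.mul_sum,
      stdSimplex.sum_eq_one, mul_one]
  exact_mod_cast this

theorem tendsto_stdSimplex_iff {V : Type u} [Fintype V] {Q : ℕ → stdSimplex ℝ V}
    {P : stdSimplex ℝ V} : Tendsto Q atTop (𝓝 P) ↔ ∀ a, Tendsto (fun n => Q n a) atTop (𝓝 (P a)) := by
  rw [tendsto_subtype_rng, tendsto_pi_nhds]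
  rfl

theorem IsSpectralPoint.isProbabilisticRefinement {f : GraphParameter.{u}} (hf : IsSpectralPoint f) :
    IsProbabilisticRefinement f fun _ _ G P => typeRate f G P := by
  intro V _ G P Q hQ hQP
  rw [tendsto_stdSimplex_iff] at hQP
  rw [Metric.tendsto_atTop]
  intro ε hε
  obtain ⟨δ, hδ, N, hN⟩ := hf.exists_abs_logType_sub_le G P.2 (half_pos hε)
  have hev : ∀ᶠ n in atTop, ∀ a, |Q n a - P a| < δ := by
    rw [eventually_all]
    intro a
    have := (hQP a).eventually (Metric.ball_mem_nhds _ hδ)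
    simpa only [Metric.mem_ball, Real.dist_eq] using this
  obtain ⟨M, hM⟩ := eventually_atTop.1 (hev.and (eventually_gt_atTop 0))
  refine ⟨max N M, fun n hn => ?_⟩
  obtain ⟨h1, h2⟩ := hM n ((le_max_right _ _).trans hn)
  have hn0 : (0 : ℝ) < n := by exact_mod_cast h2
  choose c hc using hQ n
  have h3 := hN n ((le_max_left _ _).trans hn) c (sum_of_nType hc) fun a => by
    rw [← hc a, ← mul_sub, abs_mul, abs_of_pos hn0, mul_comm]
    exact mul_le_mul_of_nonneg_right (h1 a).le hn0.le
  rw [value_typeGraph f G hc, hf.logb_typeValue G (by simp [sum_of_nType hc]), Real.dist_eq]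
  have h4 : 1 / (n : ℝ) * logType f G c - typeRate f G P =
      (logType f G c - n * typeRate f G P) / n := by
    field_simp
  rw [h4, abs_div, abs_of_pos hn0, div_lt_iff₀ hn0]
  exact h3.trans_lt (mul_lt_mul_of_pos_right (half_lt_self hε) hn0)

/-- Every distribution is a limit of `n`-types: round down all probabilities but one. -/
theorem exists_nTypes_tendsto {V : Type u} [Fintype V] (P : stdSimplex ℝ V) :
    ∃ Q : ℕ → stdSimplex ℝ V, (∀ n, IsNType n (Q n)) ∧ Tendsto Q atTop (𝓝 P) := by
  classical
  obtain ⟨b⟩ : Nonempty V := by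
    by_contra h
    rw [not_nonempty_iff] at h
    exact absurd (stdSimplex.sum_eq_one P) (by simp)
  have hP0 : ∀ a, 0 ≤ P a := P.2.1
  set q : ℕ → V → ℝ := fun n a => (⌊n * P a⌋₊ : ℝ) / n with hq
  have hqP : ∀ a, Tendsto (fun n => q n a) atTop (𝓝 (P a)) := fun a => by
    have := (tendsto_nat_floor_mul_div_atTop (hP0 a)).comp tendsto_natCast_atTop_atTop
    refine this.congr fun n => ?_
    simp [hq, mul_comm]
  have hqle : ∀ n a, q n a ≤ P a := fun n a => by
    rcases Nat.eq_zero_or_pos n with rfl | hn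
    · simp [hq, hP0 a]
    · have hn0 : (0 : ℝ) < n := by exact_mod_cast hn
      rw [hq]
      simp only
      rw [div_le_iff₀ hn0, mul_comm (P a)]
      exact Nat.floor_le (mul_nonneg hn0.le (hP0 a))
  have hq0 : ∀ n a, 0 ≤ q n a := fun n a => by positivity
  have hsplit : ∀ g : V → ℝ, ∑ a, g a = g b + ∑ a ∈ Finset.univ.erase b, g a := fun g =>
    (Finset.add_sum_erase _ _ (Finset.mem_univ b)).symm
  have hP1 : P b + ∑ a ∈ Finset.univ.erase b, P a = 1 := by
    rw [← hsplit]
    exact stdSimplex.sum_eq_one P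
  set Q : ℕ → V → ℝ := fun n a => if a = b then 1 - ∑ a ∈ Finset.univ.erase b, q n a else q n a
    with hQdef
  have hQb : ∀ n, Q n b = 1 - ∑ a ∈ Finset.univ.erase b, q n a := fun n => if_pos rfl
  have hQa : ∀ n a, a ≠ b → Q n a = q n a := fun n a h => if_neg h
  have hQ : ∀ n, Q n ∈ stdSimplex ℝ V := by
    refine fun n => ⟨fun a => ?_, ?_⟩
    · by_cases h : a = b
      · rw [h, hQb, sub_nonneg]
        have : ∑ a ∈ Finset.univ.erase b, q n a ≤ ∑ a ∈ Finset.univ.erase b, P a :=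
          Finset.sum_le_sum fun a _ => hqle n a
        linarith [hP0 b]
      · rw [hQa n a h]
        exact hq0 n a
    · rw [hsplit, hQb, Finset.sum_congr rfl fun a ha => hQa n a (Finset.ne_of_mem_erase ha)]
      ring
  refine ⟨fun n => ⟨Q n, hQ n⟩, fun n => ?_, ?_⟩
  · rcases Nat.eq_zero_or_pos n with rfl | hn
    · exact fun a => ⟨0, by simp⟩
    have hn0 : (0 : ℝ) < n := by exact_mod_cast hn
    have hnq : ∀ a, (n : ℝ) * q n a = ⌊n * P a⌋₊ := fun a => by
      rw [hq]
      field_simp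
    intro a
    change ∃ k : ℕ, (n : ℝ) * Q n a = k
    by_cases h : a = b
    · have h1 : (n : ℝ) * Q n b = n - (∑ a ∈ Finset.univ.erase b, ⌊n * P a⌋₊ : ℕ) := by
        rw [hQb, mul_sub, mul_one, Finset.mul_sum, Nat.cast_sum]
        simp only [hnq]
      have h2 : (∑ a ∈ Finset.univ.erase b, ⌊n * P a⌋₊ : ℕ) ≤ n := by
        have := mul_nonneg hn0.le ((hQ n).1 b)
        rw [h1, sub_nonneg] at this
        exact_mod_cast this
      exact ⟨n - ∑ a ∈ Finset.univ.erase b, ⌊n * P a⌋₊, by rw [h, h1, Nat.cast_sub h2]⟩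
    · exact ⟨_, by rw [hQa n a h, hnq]⟩
  · rw [tendsto_stdSimplex_iff]
    intro a
    change Tendsto (fun n => Q n a) atTop (𝓝 (P a))
    by_cases h : a = b
    · subst h
      simp only [hQb]
      have h1 : P a = 1 - ∑ a ∈ Finset.univ.erase a, P a := by linarith
      rw [h1]
      exact tendsto_const_nhds.sub (tendsto_finsetSum _ fun a _ => hqP a)
    · simp only [hQa _ a h]
      exact hqP a

theorem IsSpectralPoint.refinement_eq_typeRate {f : GraphParameter.{u}}
    (hf : IsSpectralPoint f)
    {F : ProbabilisticGraphParameter.{u}} (hF : IsProbabilisticRefinement f F) {V : Type u}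
    [Fintype V] (G : SimpleGraph V) (P : stdSimplex ℝ V) : F V G P = typeRate f G P := by
  obtain ⟨Q, hQ, hQP⟩ := exists_nTypes_tendsto P
  exact tendsto_nhds_unique (hF V G P Q hQ hQP) (hf.isProbabilisticRefinement V G P Q hQ hQP)

theorem IsSpectralPoint.existsUnique_refinement {f : GraphParameter.{u}}
    (hf : IsSpectralPoint f) :
    ∃! F : ProbabilisticGraphParameter.{u}, IsProbabilisticRefinement f F := by
  refine ⟨_, hf.isProbabilisticRefinement, fun F hF => ?_⟩
  funext V _ G P
  exact hf.refinement_eq_typeRate hF G P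

/-! ### The weak law of large numbers for finite Markov chains -/

/-- The probability of a word of length `m + 1` under the Markov chain with initial
distribution `π` and transition matrix `K`. -/
noncomputable def chainWeight {X : Type*} (π : X → ℝ) (K : X → X → ℝ) (m : ℕ)
    (y : Fin (m + 1) → X) : ℝ :=
  π (y 0) * ∏ i : Fin m, K (y i.castSucc) (y i.succ)

theorem chainWeight_zero {X : Type*} (π : X → ℝ) (K : X → X → ℝ) (y : Fin 1 → X) :
    chainWeight π K 0 y = π (y 0) := by
  simp [chainWeight]

theorem chainWeight_snoc {X : Type*} (π : X → ℝ) (K : X → X → ℝ) (m : ℕ) (y : Fin (m + 1) → X)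
    (b : X) :
    chainWeight π K (m + 1) (Fin.snoc (α := fun _ => X) y b) =
      chainWeight π K m y * K (y (Fin.last m)) b := by
  rw [chainWeight, chainWeight, Fin.prod_univ_castSucc, ← mul_assoc]
  congr 1
  · congr 1
    refine Finset.prod_congr rfl fun i _ => ?_
    rw [← Fin.castSucc_succ i, Fin.snoc_castSucc, Fin.snoc_castSucc]
  · rw [Fin.snoc_castSucc, Fin.succ_last, Fin.snoc_last]

theorem sum_word_snoc {X : Type*} [Fintype X] (m : ℕ) (φ : (Fin (m + 1) → X) → ℝ) :
    ∑ y, φ y = ∑ y : Fin m → X, ∑ b, φ (Fin.snoc (α := fun _ => X) y b) := by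
  rw [Finset.sum_comm, ← Fintype.sum_prod_type',
    ← (Fin.snocEquiv fun _ : Fin (m + 1) => X).sum_comp]
  rfl

theorem sum_indicator_letterCount {X ι : Type*} [Fintype ι] [DecidableEq X] (y : ι → X) (x : X) :
    ∑ i, (if y i = x then (1 : ℝ) else 0) = letterCount y x := by
  rw [letterCount, Nat.card_eq_fintype_card, Fintype.card_subtype, Finset.sum_boole]

/-- The vector `π` is a probability distribution that is stationary for the stochastic
matrix `K`. -/
structure IsStationaryChain {X : Type*} [Fintype X] (π : X → ℝ) (K : X → X → ℝ) : Prop where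
  init_nonneg : ∀ x, 0 ≤ π x
  init_sum : ∑ x, π x = 1
  nonneg : ∀ x y, 0 ≤ K x y
  sum_eq_one : ∀ x, ∑ y, K x y = 1
  stationary : ∀ y, ∑ x, π x * K x y = π y

namespace IsStationaryChain

variable {X : Type*} [Fintype X] {π : X → ℝ} {K : X → X → ℝ}

theorem chainWeight_nonneg (h : IsStationaryChain π K) (m : ℕ) (y : Fin (m + 1) → X) :
    0 ≤ chainWeight π K m y :=
  mul_nonneg (h.init_nonneg _) (Finset.prod_nonneg fun _ _ => h.nonneg _ _)

theorem sum_chainWeight_last (h : IsStationaryChain π K) (φ : X → ℝ) (m : ℕ) :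
    ∑ y, chainWeight π K m y * φ (y (Fin.last m)) = ∑ x, π x * φ x := by
  induction m generalizing φ with
  | zero =>
    rw [← (Equiv.funUnique (Fin 1) X).symm.sum_comp]
    exact Finset.sum_congr rfl fun x _ => by rw [chainWeight_zero]; rfl
  | succ m ih =>
    rw [sum_word_snoc]
    simp only [chainWeight_snoc, Fin.snoc_last, mul_assoc, ← Finset.mul_sum]
    rw [ih fun x => ∑ b, K x b * φ b]
    simp only [Finset.mul_sum]
    rw [Finset.sum_comm]
    refine Finset.sum_congr rfl fun b _ => ?_
    rw [← h.stationary b, Finset.sum_mul]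
    exact Finset.sum_congr rfl fun x _ => by ring

theorem sum_chainWeight (h : IsStationaryChain π K) (m : ℕ) :
    ∑ y, chainWeight π K m y = 1 := by
  simpa [h.init_sum] using h.sum_chainWeight_last (fun _ => 1) m

/-- The maximum principle: a harmonic function takes its maximum at every state that can be
reached from all others. -/
theorem harmonic_eq_max (h : IsStationaryChain π K) {φ : X → ℝ}
    (hφ : ∀ x, φ x = ∑ y, K x y * φ y) {a b : X} (ha : ∀ x, φ x ≤ φ a)
    (hab : Relation.ReflTransGen (fun x y => 0 < K x y) a b) : φ b = φ a := by
  induction hab with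
  | refl => rfl
  | @tail x y _ hxy ih =>
    by_contra hne
    have hlt : φ y < φ a := lt_of_le_of_ne (ha y) hne
    have : ∑ z, K x z * φ z < ∑ z, K x z * φ a :=
      Finset.sum_lt_sum (fun z _ => mul_le_mul_of_nonneg_left (ha z) (h.nonneg x z))
        ⟨y, Finset.mem_univ _, mul_lt_mul_of_pos_left hlt hxy⟩
    rw [← hφ, ih, ← Finset.sum_mul, h.sum_eq_one, one_mul] at this
    exact lt_irrefl _ this

theorem harmonic_const (h : IsStationaryChain π K) {b : X}
    (hb : ∀ x, Relation.ReflTransGen (fun x y => 0 < K x y) x b) {φ : X → ℝ}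
    (hφ : ∀ x, φ x = ∑ y, K x y * φ y) (x : X) : φ x = φ b := by
  have : Nonempty X := ⟨b⟩
  obtain ⟨a, ha⟩ := Finite.exists_max φ
  obtain ⟨a', ha'⟩ := Finite.exists_min φ
  have h1 := h.harmonic_eq_max hφ ha (hb a)
  have h2 := h.harmonic_eq_max (φ := fun x => -φ x) (a := a') (b := b)
    (fun x => by simp only [mul_neg, Finset.sum_neg_distrib]; rw [← hφ])
    (fun x => neg_le_neg (ha' x)) (hb a')
  have h3 := ha x
  have h4 := ha' x
  linarith

/-- The Poisson equation: if the harmonic functions are constant, every function of mean zero is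
of the form `φ - K φ`, by counting dimensions. -/
theorem exists_poisson (h : IsStationaryChain π K) {b : X}
    (hb : ∀ x, Relation.ReflTransGen (fun x y => 0 < K x y) x b) {g : X → ℝ}
    (hg : ∑ x, π x * g x = 0) : ∃ φ : X → ℝ, ∀ x, g x = φ x - ∑ y, K x y * φ y := by
  classical
  set T : (X → ℝ) →ₗ[ℝ] (X → ℝ) := LinearMap.id - Matrix.mulVecLin (Matrix.of K) with hT
  have hTφ : ∀ φ x, T φ x = φ x - ∑ y, K x y * φ y := fun φ x => rfl
  set ℓ : (X → ℝ) →ₗ[ℝ] ℝ := Fintype.linearCombination ℝ π with hℓ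
  have hℓφ : ∀ φ, ℓ φ = ∑ x, π x * φ x := fun φ => by
    simp [hℓ, Fintype.linearCombination_apply, mul_comm]
  have hle : LinearMap.range T ≤ LinearMap.ker ℓ := by
    rintro _ ⟨φ, rfl⟩
    rw [LinearMap.mem_ker, hℓφ]
    simp only [hTφ, mul_sub, Finset.sum_sub_distrib, Finset.mul_sum]
    rw [Finset.sum_comm (f := fun x y => π x * (K x y * φ y)), sub_eq_zero]
    refine Finset.sum_congr rfl fun y _ => ?_
    rw [← h.stationary y, Finset.sum_mul]
    exact Finset.sum_congr rfl fun x _ => by ring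
  have hker : LinearMap.ker T ≤ ℝ ∙ (fun _ : X => (1 : ℝ)) := by
    intro φ hφ
    rw [Submodule.mem_span_singleton]
    refine ⟨φ b, ?_⟩
    ext x
    have hφ' : ∀ x, φ x = ∑ y, K x y * φ y := fun x => by
      have := congrFun (LinearMap.mem_ker.1 hφ) x
      rw [hTφ] at this
      exact sub_eq_zero.1 this
    simp [h.harmonic_const hb hφ' x]
  have hker1 : Module.finrank ℝ (LinearMap.ker T) ≤ 1 :=
    (Submodule.finrank_mono hker).trans ((finrank_span_le_card _).trans_eq (by simp))
  have hT1 := T.finrank_range_add_finrank_ker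
  have hℓ1 := ℓ.finrank_range_add_finrank_ker
  have hℓs : Function.Surjective ℓ := fun r => ⟨fun _ => r, by
    rw [hℓφ, ← Finset.sum_mul, h.init_sum, one_mul]⟩
  rw [LinearMap.range_eq_top.2 hℓs, finrank_top, Module.finrank_self] at hℓ1
  have heq := Submodule.eq_of_le_of_finrank_le hle (by omega)
  have hmem : g ∈ LinearMap.range T := by
    rw [heq, LinearMap.mem_ker, hℓφ]
    exact hg
  obtain ⟨φ, hφ⟩ := hmem
  exact ⟨φ, fun x => by rw [← hφ, hTφ]⟩

/-- If `g = φ - K φ`, then `∑ g(yᵢ) + K φ(y_m)` is a martingale with bounded increments, so its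
second moment grows linearly. -/
theorem sum_chainWeight_martingale_sq_le (h : IsStationaryChain π K) {φ : X → ℝ} {R : ℝ}
    (hR : ∀ x, |φ x| ≤ R) (m : ℕ) :
    ∑ y, chainWeight π K m y * (∑ i, (φ (y i) - ∑ b, K (y i) b * φ b) +
      ∑ b, K (y (Fin.last m)) b * φ b) ^ 2 ≤ (m + 1) * (4 * R ^ 2) := by
  have hKφ : ∀ x, |∑ b, K x b * φ b| ≤ R := fun x => by
    refine (Finset.abs_sum_le_sum_abs _ _).trans ?_
    calc ∑ b, |K x b * φ b| ≤ ∑ b, K x b * R := Finset.sum_le_sum fun b _ => by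
          rw [abs_mul, abs_of_nonneg (h.nonneg x b)]
          exact mul_le_mul_of_nonneg_left (hR b) (h.nonneg x b)
      _ = R := by rw [← Finset.sum_mul, h.sum_eq_one, one_mul]
  induction m with
  | zero =>
    calc _ ≤ ∑ y, chainWeight π K 0 y * (4 * R ^ 2) := by
          refine Finset.sum_le_sum fun y _ => mul_le_mul_of_nonneg_left ?_
            (h.chainWeight_nonneg 0 y)
          have h1 := sq_le_sq' (neg_le_of_abs_le (hR (y 0))) (le_of_abs_le (hR (y 0)))
          have h2 : ∑ i, (φ (y i) - ∑ b, K (y i) b * φ b) +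
              ∑ b, K (y (Fin.last 0)) b * φ b = φ (y 0) := by simp
          rw [h2]
          nlinarith [sq_nonneg R]
      _ = _ := by rw [← Finset.sum_mul, h.sum_chainWeight]; simp
  | succ m ih =>
    rw [sum_word_snoc]
    have hstep : ∀ y : Fin (m + 1) → X, ∑ b, chainWeight π K (m + 1)
        (Fin.snoc (α := fun _ => X) y b) *
        (∑ i, (φ (Fin.snoc (α := fun _ => X) y b i) -
          ∑ b', K (Fin.snoc (α := fun _ => X) y b i) b' * φ b') +
          ∑ b', K (Fin.snoc (α := fun _ => X) y b (Fin.last (m + 1))) b' * φ b') ^ 2 ≤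
        chainWeight π K m y * (∑ i, (φ (y i) - ∑ b, K (y i) b * φ b) +
          ∑ b, K (y (Fin.last m)) b * φ b) ^ 2 + chainWeight π K m y * (4 * R ^ 2) := by
      intro y
      set S := ∑ i, (φ (y i) - ∑ b, K (y i) b * φ b) with hS
      set l := y (Fin.last m) with hl
      set k := ∑ b, K l b * φ b with hk
      have h1 : ∀ b, (∑ i, (φ (Fin.snoc (α := fun _ => X) y b i) -
          ∑ b', K (Fin.snoc (α := fun _ => X) y b i) b' * φ b') +
          ∑ b', K (Fin.snoc (α := fun _ => X) y b (Fin.last (m + 1))) b' * φ b') = S + φ b := by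
        intro b
        rw [Fin.sum_univ_castSucc]
        simp only [Fin.snoc_castSucc, Fin.snoc_last]
        rw [← hS]
        ring
      simp only [h1, chainWeight_snoc]
      have hw := h.chainWeight_nonneg m y
      -- The cross term vanishes because `k` is the conditional mean of `φ` at the next letter.
      have h2 : ∑ b, K l b * (S + φ b) ^ 2 = (S + k) ^ 2 + ∑ b, K l b * (φ b - k) ^ 2 := by
        have e1 : ∀ b, K l b * (S + φ b) ^ 2 = K l b * (S + k) ^ 2 +
            2 * (S + k) * (K l b * φ b) - 2 * (S + k) * k * K l b +
              K l b * (φ b - k) ^ 2 := fun b => by ring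
        simp only [e1, Finset.sum_add_distrib, Finset.sum_sub_distrib, ← Finset.sum_mul,
          ← Finset.mul_sum, h.sum_eq_one]
        rw [← hk]
        ring
      have h3 : ∑ b, K l b * (φ b - k) ^ 2 ≤ 4 * R ^ 2 := by
        calc _ ≤ ∑ b, K l b * (4 * R ^ 2) := Finset.sum_le_sum fun b _ => by
              refine mul_le_mul_of_nonneg_left ?_ (h.nonneg _ _)
              have h4 := abs_le.1 (hR b)
              have h5 := abs_le.1 (hKφ l)
              have h6 : (φ b - k) ^ 2 ≤ (2 * R) ^ 2 :=
                sq_le_sq' (by linarith [h4.1, h5.2]) (by linarith [h4.2, h5.1])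
              linarith [h6]
          _ = _ := by rw [← Finset.sum_mul, h.sum_eq_one, one_mul]
      calc ∑ b, chainWeight π K m y * K l b * (S + φ b) ^ 2
          = chainWeight π K m y * ∑ b, K l b * (S + φ b) ^ 2 := by
            rw [Finset.mul_sum]
            exact Finset.sum_congr rfl fun b _ => by ring
        _ ≤ _ := by
            rw [h2, mul_add]
            exact add_le_add_right (mul_le_mul_of_nonneg_left h3 hw) _
    refine (Finset.sum_le_sum fun y _ => hstep y).trans ?_
    rw [Finset.sum_add_distrib, ← Finset.sum_mul, h.sum_chainWeight]
    push_cast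
    linarith

open Classical in
/-- Chebyshev's inequality for the sum of a function of mean zero along the chain. -/
theorem exists_sum_chainWeight_deviation_le (h : IsStationaryChain π K) {b : X}
    (hb : ∀ x, Relation.ReflTransGen (fun x y => 0 < K x y) x b) {g : X → ℝ}
    (hg : ∑ x, π x * g x = 0) :
    ∃ C : ℝ, ∀ δ > 0, ∀ m : ℕ,
      ∑ y with δ * (m + 1) < |∑ i, g (y i)|, chainWeight π K m y ≤ C / (δ ^ 2 * (m + 1)) := by
  obtain ⟨φ, hφ⟩ := h.exists_poisson hb hg
  obtain ⟨R, hR⟩ : ∃ R : ℝ, ∀ x, |φ x| ≤ R :=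
    ⟨∑ x, |φ x|, fun x => Finset.single_le_sum (f := fun x => |φ x|)
      (fun _ _ => abs_nonneg _) (Finset.mem_univ x)⟩
  have hKφ : ∀ x, |∑ b, K x b * φ b| ≤ R := fun x => by
    refine (Finset.abs_sum_le_sum_abs _ _).trans ?_
    calc ∑ b, |K x b * φ b| ≤ ∑ b, K x b * R := Finset.sum_le_sum fun b _ => by
          rw [abs_mul, abs_of_nonneg (h.nonneg x b)]
          exact mul_le_mul_of_nonneg_left (hR b) (h.nonneg x b)
      _ = R := by rw [← Finset.sum_mul, h.sum_eq_one, one_mul]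
  refine ⟨10 * R ^ 2, fun δ hδ m => ?_⟩
  have hm : (0 : ℝ) < m + 1 := by positivity
  have h1 := h.sum_chainWeight_martingale_sq_le hR m
  simp only [← hφ] at h1
  have h2 : ∑ y, chainWeight π K m y * (∑ i, g (y i)) ^ 2 ≤ 10 * R ^ 2 * (m + 1) := by
    calc ∑ y, chainWeight π K m y * (∑ i, g (y i)) ^ 2
        ≤ ∑ y, (2 * (chainWeight π K m y * (∑ i, g (y i) +
            ∑ b, K (y (Fin.last m)) b * φ b) ^ 2) + chainWeight π K m y * (2 * R ^ 2)) := by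
          refine Finset.sum_le_sum fun y _ => ?_
          have hk := abs_le.1 (hKφ (y (Fin.last m)))
          have hw := h.chainWeight_nonneg m y
          set S := ∑ i, g (y i)
          set k := ∑ b, K (y (Fin.last m)) b * φ b
          have hk2 : k ^ 2 ≤ R ^ 2 := sq_le_sq' hk.1 hk.2
          have : S ^ 2 ≤ 2 * (S + k) ^ 2 + 2 * R ^ 2 := by nlinarith [sq_nonneg (S + 2 * k)]
          calc chainWeight π K m y * S ^ 2
              ≤ chainWeight π K m y * (2 * (S + k) ^ 2 + 2 * R ^ 2) :=
                mul_le_mul_of_nonneg_left this hw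
            _ = _ := by ring
      _ ≤ 10 * R ^ 2 * (m + 1) := by
          rw [Finset.sum_add_distrib, ← Finset.mul_sum, ← Finset.sum_mul, h.sum_chainWeight]
          nlinarith [sq_nonneg R, mul_nonneg (sq_nonneg R) (Nat.cast_nonneg (α := ℝ) m)]
  have h3 : (δ * (m + 1)) ^ 2 *
      ∑ y with δ * (m + 1) < |∑ i, g (y i)|, chainWeight π K m y ≤ 10 * R ^ 2 * (m + 1) := by
    refine le_trans ?_ h2
    rw [Finset.mul_sum]
    refine (Finset.sum_le_sum fun y hy => ?_).trans
      (Finset.sum_le_sum_of_subset_of_nonneg (Finset.filter_subset _ _) fun y _ _ =>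
        mul_nonneg (h.chainWeight_nonneg m y) (sq_nonneg _))
    rw [mul_comm]
    refine mul_le_mul_of_nonneg_left ?_ (h.chainWeight_nonneg m y)
    rw [← sq_abs (∑ i, g (y i))]
    exact pow_le_pow_left₀ (by positivity) (Finset.mem_filter.1 hy).2.le 2
  rw [le_div_iff₀ (by positivity)]
  have h4 : (δ * (m + 1)) ^ 2 = δ ^ 2 * (m + 1) * (m + 1) := by ring
  rw [h4] at h3
  nlinarith

open Classical in
/-- The weak law of large numbers: the letter frequencies of a chain with a state that can be
reached from everywhere converge in probability to the stationary distribution. -/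
theorem tendsto_sum_chainWeight_atypical (h : IsStationaryChain π K) {b : X}
    (hb : ∀ x, Relation.ReflTransGen (fun x y => 0 < K x y) x b) {δ : ℝ} (hδ : 0 < δ) :
    Tendsto (fun m : ℕ => ∑ y with ∃ x, δ * (m + 1) < |(letterCount y x : ℝ) - (m + 1) * π x|,
      chainWeight π K m y) atTop (𝓝 0) := by
  have hC : ∀ x, ∃ C : ℝ, ∀ δ > 0, ∀ m : ℕ,
      ∑ y : Fin (m + 1) → X with δ * (m + 1) < |(letterCount y x : ℝ) - (m + 1) * π x|,
        chainWeight π K m y ≤ C / (δ ^ 2 * (m + 1)) := by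
    intro x
    obtain ⟨C, hC⟩ := h.exists_sum_chainWeight_deviation_le hb
      (g := fun z => (if z = x then 1 else 0) - π x) (by
        simp [mul_sub, Finset.sum_sub_distrib, ← Finset.sum_mul, h.init_sum])
    refine ⟨C, fun δ hδ m => ?_⟩
    have := hC δ hδ m
    simpa [Finset.sum_sub_distrib, sum_indicator_letterCount, -Finset.sum_boole] using this
  choose C hC using hC
  have hlim : Tendsto (fun m : ℕ => ∑ x, C x / (δ ^ 2 * (m + 1))) atTop (𝓝 0) := by
    rw [← Finset.sum_const_zero (ι := X) (s := Finset.univ)]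
    refine tendsto_finsetSum _ fun x _ => Tendsto.div_atTop tendsto_const_nhds ?_
    exact Tendsto.const_mul_atTop (by positivity)
      (tendsto_atTop_add_const_right _ _ tendsto_natCast_atTop_atTop)
  refine squeeze_zero (fun m => Finset.sum_nonneg fun y _ => h.chainWeight_nonneg m y)
    (fun m => ?_) hlim
  refine le_trans ?_ (Finset.sum_le_sum fun x _ => hC x δ hδ m)
  simp only [Finset.sum_filter]
  rw [Finset.sum_comm]
  refine Finset.sum_le_sum fun y _ => ?_
  have h0 : ∀ x, 0 ≤ if δ * (m + 1) < |(letterCount y x : ℝ) - (m + 1) * π x| then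
      chainWeight π K m y else 0 := fun x => by
    split_ifs
    exacts [h.chainWeight_nonneg m y, le_rfl]
  split_ifs with hy
  · obtain ⟨x, hx⟩ := hy
    refine le_trans ?_ (Finset.single_le_sum (fun x _ => h0 x) (Finset.mem_univ x))
    rw [if_pos hx]
  · exact Finset.sum_nonneg fun x _ => h0 x

end IsStationaryChain

/-! ### Equipartition for chains dominated by their stationary distribution -/

/-- Confusability-preserving maps do not increase spectral points of images: choose preimages. -/
theorem IsSpectralPoint.image_le {f : GraphParameter.{u}} (hf : IsSpectralPoint f) {A B : Type u}
    [Finite A] [Finite B] {H : SimpleGraph A} {K : SimpleGraph B} (φ : A → B)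
    (h : ∀ a a', Confusable H a a' → Confusable K (φ a) (φ a')) (S : Set A) :
    f (φ '' S : Set B) (K.induce (φ '' S)) ≤ f S (H.induce S) := by
  choose g hg hgφ using fun b : φ '' S => b.2
  refine hf.le_of_map (fun b => ⟨g b, hg b⟩) fun b b' hc => ?_
  rw [confusable_induce] at hc ⊢
  simpa only [hgφ] using h _ _ hc

theorem exists_perm_of_letterCount_eq {V ι : Type*} [Finite ι] {x y : ι → V}
    (h : ∀ a, letterCount x a = letterCount y a) : ∃ σ : Equiv.Perm ι, x ∘ σ = y := by
  have e : ∀ a, {i // y i = a} ≃ {i // x i = a} := fun a => (Finite.card_eq.1 (h a).symm).some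
  exact ⟨Equiv.ofFiberEquiv e, funext fun i => Equiv.ofFiberEquiv_map e i⟩

/-- Permutations of the coordinates act on type classes. -/
@[reducible]
def typeSetAction {V ι : Type*} (c : V → ℕ) :
    MulAction (Equiv.Perm ι) (typeSet ι c) where
  smul g x := ⟨x.1 ∘ (g⁻¹ : Equiv.Perm ι), fun a => (letterCount_comp_equiv _ _ _).trans (x.2 a)⟩
  one_smul _ := rfl
  mul_smul _ _ _ := rfl

/-- A subset of density `η` in a type class has almost the same value as the whole type class,
because type classes are vertex-transitive. -/
theorem IsSpectralPoint.typeValue_le_of_density {f : GraphParameter.{u}}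
    (hf : IsSpectralPoint f) {V : Type u} [Finite V] (G : SimpleGraph V) {ι : Type} [Finite ι]
    {c : V → ℕ} (hne : (typeSet ι c).Nonempty) (S : Set (ι → V)) {η : ℝ} (hη : 0 < η)
    (hS : η * Nat.card (typeSet ι c) ≤ Nat.card (S ∩ typeSet ι c : Set (ι → V))) :
    typeValue f G ι c ≤ (Real.log (Nat.card (typeSet ι c)) / η + 1) *
      f S ((powerGraph G ι).induce S) := by
  let _ := typeSetAction (ι := ι) c
  have : Nonempty (typeSet ι c) := hne.to_subtype
  have htrans : MulAction.IsPretransitive (Equiv.Perm ι) (typeSet ι c) := by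
    refine ⟨fun x y => ?_⟩
    obtain ⟨σ, hσ⟩ := exists_perm_of_letterCount_eq
      fun a => (x.2 a).trans (y.2 a).symm
    refine ⟨σ⁻¹, Subtype.ext ?_⟩
    change x.1 ∘ ((σ⁻¹)⁻¹ : Equiv.Perm ι) = y.1
    rw [inv_inv, hσ]
  have hcard : Nat.card (S ∩ typeSet ι c : Set (ι → V)) =
      Nat.card {x : typeSet ι c | x.1 ∈ S} :=
    Nat.card_congr
      ⟨fun x => ⟨⟨x.1, x.2.2⟩, x.2.1⟩, fun x => ⟨x.1.1, x.2, x.1.2⟩, fun _ => rfl, fun _ => rfl⟩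
  rw [hcard] at hS
  refine (hf.le_mul_of_pretransitive (Γ := Equiv.Perm ι) ((powerGraph G ι).induce (typeSet ι c))
    (fun g x y => ?_) {x | x.1 ∈ S} hη hS).trans (mul_le_mul_of_nonneg_left ?_ ?_)
  · rw [confusable_induce, confusable_induce, confusable_powerGraph, confusable_powerGraph]
    change (∀ i, Confusable G (x.1 (g⁻¹ i)) (y.1 (g⁻¹ i))) ↔ _
    exact ⟨fun h i => by simpa using h (g i), fun h i => h _⟩
  · refine hf.le_of_map (fun x => ⟨x.1.1, x.2⟩) fun x y hc => ?_
    rw [confusable_induce] at hc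
    rwa [confusable_induce, confusable_induce]
  · have h1 : (1 : ℝ) ≤ Nat.card (typeSet ι c) := by exact_mod_cast Nat.card_pos
    have := Real.log_nonneg h1
    positivity

theorem eventually_mul_pow_le_rpow (A : ℝ) (d : ℕ) {ε : ℝ} (hε : 0 < ε) :
    ∀ᶠ n : ℕ in atTop, A * ((n : ℝ) + 1) ^ d ≤ (2 : ℝ) ^ (n * ε) := by
  have h2 : (1 : ℝ) < 2 ^ ε := Real.one_lt_rpow one_lt_two hε
  have h1 : Tendsto (fun n : ℕ => |A| * 2 ^ d * ((n : ℝ) ^ d / ((2 : ℝ) ^ ε) ^ n)) atTop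
      (𝓝 (|A| * 2 ^ d * 0)) :=
    (tendsto_pow_const_div_const_pow_of_one_lt d h2).const_mul _
  rw [mul_zero] at h1
  filter_upwards [h1.eventually_lt_const one_pos, eventually_ge_atTop 1] with n hn hn1
  have hn1' : (1 : ℝ) ≤ n := by exact_mod_cast hn1
  have hpos : (0 : ℝ) < ((2 : ℝ) ^ ε) ^ n := by positivity
  rw [← mul_div_assoc, div_lt_one hpos] at hn
  rw [mul_comm (n : ℝ), Real.rpow_mul two_pos.le, Real.rpow_natCast]
  refine le_trans ?_ hn.le
  calc A * ((n : ℝ) + 1) ^ d ≤ |A| * (2 * n) ^ d :=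
        mul_le_mul (le_abs_self A) (pow_le_pow_left₀ (by positivity) (by linarith) d)
          (by positivity) (abs_nonneg A)
    _ = _ := by rw [mul_pow]; ring

theorem prod_eq_prod_pow_letterCount {X ι : Type*} [Fintype X] [Fintype ι] (π : X → ℝ)
    (y : ι → X) : ∏ i, π (y i) = ∏ x, π x ^ letterCount y x := by
  classical
  rw [← Finset.prod_fiberwise' Finset.univ y π]
  refine Finset.prod_congr rfl fun x _ => ?_
  rw [Finset.prod_const, letterCount, Nat.card_eq_fintype_card, Fintype.card_subtype]

open Classical in
/-- The letter counts of length `n` that deviate from `n π` by at most `δ n` in each letter. -/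
noncomputable def nearCounts {X : Type*} [Fintype X] (π : X → ℝ) (δ : ℝ) (n : ℕ) :
    Finset (X → ℕ) :=
  (Fintype.piFinset fun _ => Finset.range (n + 1)).filter fun c =>
    ∑ x, c x = n ∧ ∀ x, |(c x : ℝ) - n * π x| ≤ δ * n

theorem card_nearCounts_le {X : Type*} [Fintype X] (π : X → ℝ) (δ : ℝ) (n : ℕ) :
    ((nearCounts π δ n).card : ℝ) ≤ ((n : ℝ) + 1) ^ Fintype.card X := by
  classical
  refine (Nat.cast_le.2 (Finset.card_filter_le _ _)).trans ?_
  rw [Fintype.card_piFinset]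
  simp

theorem letterCount_mem_nearCounts {X : Type*} [Fintype X] {π : X → ℝ} {δ : ℝ} {n : ℕ}
    {y : Fin n → X} (hy : ∀ x, |(letterCount y x : ℝ) - n * π x| ≤ δ * n) :
    letterCount y ∈ nearCounts π δ n := by
  classical
  refine Finset.mem_filter.2 ⟨?_, ?_, hy⟩
  · rw [Fintype.mem_piFinset]
    intro x
    have := letterCount_le y x
    rw [Nat.card_fin] at this
    exact Finset.mem_range.2 (Nat.lt_succ_of_le this)
  · rw [sum_letterCount, Nat.card_fin]

theorem mem_nearCounts {X : Type*} [Fintype X] {π : X → ℝ} {δ : ℝ} {n : ℕ} {c : X → ℕ}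
    (hc : c ∈ nearCounts π δ n) : ∑ x, c x = n ∧ ∀ x, |(c x : ℝ) - n * π x| ≤ δ * n := by
  classical
  exact (Finset.mem_filter.1 hc).2

theorem IsStationaryChain.init_mem {X : Type*} [Fintype X] {π : X → ℝ} {K : X → X → ℝ}
    (h : IsStationaryChain π K) : π ∈ stdSimplex ℝ X :=
  ⟨h.init_nonneg, h.init_sum⟩

open Classical in
/-- The typical set has probability tending to one, and consists of polynomially many type
classes near `π`. -/
theorem IsStationaryChain.eventually_exists_set {X : Type u} [Fintype X] {π : X → ℝ}
    {K : X → X → ℝ} (h : IsStationaryChain π K) {b : X}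
    (hb : ∀ x, Relation.ReflTransGen (fun x y => 0 < K x y) x b) {f : GraphParameter.{u}}
    (hf : IsSpectralPoint f) (H : SimpleGraph X) {c : ℝ} (hc0 : 0 < c) (hc : c < 1) {ε : ℝ}
    (hε : 0 < ε) :
    ∀ᶠ m : ℕ in atTop, ∃ S : Set (Fin (m + 1) → X), c ≤ ∑ y with y ∈ S, chainWeight π K m y ∧
      Real.logb 2 (f S ((powerGraph H (Fin (m + 1))).induce S)) ≤
        (m + 1) * (typeRate f H π + ε) := by
  obtain ⟨δ, hδ, N, hN⟩ := hf.exists_abs_logType_sub_le H h.init_mem (half_pos hε)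
  have hpoly := (tendsto_add_atTop_nat 1).eventually
    (eventually_mul_pow_le_rpow 1 (Fintype.card X) (half_pos hε))
  filter_upwards [(h.tendsto_sum_chainWeight_atypical hb hδ).eventually_lt_const (sub_pos.2 hc),
    hpoly, eventually_ge_atTop N] with m hm hpoly hmN
  simp only [one_mul] at hpoly
  obtain ⟨S, hS⟩ : ∃ S : Set (Fin (m + 1) → X), ∀ y, y ∈ S ↔
      ∀ x, |(letterCount y x : ℝ) - (m + 1 : ℕ) * π x| ≤ δ * (m + 1 : ℕ) :=
    ⟨{y | _}, fun _ => Iff.rfl⟩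
  have hSc : c ≤ ∑ y with y ∈ S, chainWeight π K m y := by
    have h1 := Finset.sum_filter_add_sum_filter_not Finset.univ (· ∈ S) (chainWeight π K m)
    rw [h.sum_chainWeight] at h1
    have h2 : (Finset.univ.filter fun y => y ∉ S) = Finset.univ.filter fun y : Fin (m + 1) → X =>
        ∃ x, δ * (m + 1) < |(letterCount y x : ℝ) - (m + 1) * π x| := by
      ext y
      simp [hS]
    rw [h2] at h1
    linarith
  refine ⟨S, hSc, ?_⟩
  have hSne : S.Nonempty := by
    by_contra hne
    rw [Set.not_nonempty_iff_eq_empty] at hne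
    rw [hne] at hSc
    simp at hSc
    linarith
  have := hSne.to_subtype
  have h1 : f S ((powerGraph H (Fin (m + 1))).induce S) ≤
      (nearCounts π δ (m + 1)).card *
        (2 : ℝ) ^ (((m + 1 : ℕ) : ℝ) * (typeRate f H π + ε / 2)) := by
    refine hf.induce_le_card_mul _ _ (fun c => typeSet (Fin (m + 1)) c)
      (fun y hy => ⟨letterCount y, letterCount_mem_nearCounts ((hS y).1 hy), fun _ => rfl⟩) fun c hcm => ?_
    obtain ⟨hc1, hc2⟩ := mem_nearCounts hcm
    have hcard : Nat.card (Fin (m + 1)) = ∑ x, c x := by rw [hc1, Nat.card_fin]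
    have h3 := abs_le.1 (hN (m + 1) (by omega) c hc1 hc2)
    change typeValue f H (Fin (m + 1)) c ≤ _
    rw [← Real.logb_le_iff_le_rpow one_lt_two (hf.typeValue_pos H hcard),
      hf.logb_typeValue H hcard]
    linarith [h3.2]
  rw [Real.logb_le_iff_le_rpow one_lt_two (zero_lt_one.trans_le (hf.one_le _))]
  refine h1.trans ((mul_le_mul_of_nonneg_right ((card_nearCounts_le π δ (m + 1)).trans hpoly)
    (by positivity)).trans_eq ?_)
  rw [← Real.rpow_add two_pos]
  congr 1
  push_cast
  ring

theorem IsStationaryChain.chainWeight_le {X : Type u} [Fintype X] {π : X → ℝ}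
    {K : X → X → ℝ} (h : IsStationaryChain π K) {C : ℝ} (hC : 1 ≤ C)
    (hK : ∀ x y, K x y ≤ C * π y) (m : ℕ) (y : Fin (m + 1) → X) :
    chainWeight π K m y ≤ C ^ (m + 1) * ∏ i, π (y i) := by
  rw [chainWeight, Fin.prod_univ_succ, mul_left_comm]
  refine mul_le_mul_of_nonneg_left ?_ (h.init_nonneg _)
  have h0 : 0 ≤ ∏ i : Fin m, π (y i.succ) := Finset.prod_nonneg fun _ _ => h.init_nonneg _
  calc ∏ i : Fin m, K (y i.castSucc) (y i.succ) ≤ ∏ i : Fin m, C * π (y i.succ) :=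
        Finset.prod_le_prod (fun _ _ => h.nonneg _ _) fun _ _ => hK _ _
    _ = C ^ m * ∏ i : Fin m, π (y i.succ) := by
        rw [Finset.prod_mul_distrib, Finset.prod_const, Finset.card_univ, Fintype.card_fin]
    _ ≤ _ := mul_le_mul_of_nonneg_right (pow_le_pow_right₀ hC (Nat.le_succ m)) h0

open Classical in
/-- A set of words with non-negligible probability under the chain has, under the product
distribution `π ^ n ≥ C⁻ⁿ · law`, a share of at least `C⁻ⁿ` up to polynomial factors of some type
class near `π`. -/
theorem IsStationaryChain.exists_dense_typeSet {X : Type u} [Fintype X] {π : X → ℝ}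
    {K : X → X → ℝ} (h : IsStationaryChain π K) {C : ℝ} (hC : 1 ≤ C)
    (hK : ∀ x y, K x y ≤ C * π y) {δ c : ℝ} (hc0 : 0 < c) {m : ℕ}
    {S : Set (Fin (m + 1) → X)} (hS : c ≤ ∑ y with y ∈ S, chainWeight π K m y)
    (hm : ∑ y with ∃ x, δ * (m + 1) < |(letterCount y x : ℝ) - (m + 1) * π x|,
      chainWeight π K m y ≤ c / 2) :
    ∃ d ∈ nearCounts π δ (m + 1),
      c / 2 / (C ^ (m + 1) * (((m + 1 : ℕ) : ℝ) + 1) ^ Fintype.card X) *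
        Nat.card (typeSet (Fin (m + 1)) d) ≤
          Nat.card (S ∩ typeSet (Fin (m + 1)) d : Set (Fin (m + 1) → X)) := by
  have hC0 : 0 < C := one_pos.trans_le hC
  set T : Finset (Fin (m + 1) → X) := Finset.univ.filter fun y =>
    y ∈ S ∧ letterCount y ∈ nearCounts π δ (m + 1) with hT
  have hTw : c / 2 ≤ ∑ y ∈ T, chainWeight π K m y := by
    have h1 : ∑ y with y ∈ S, chainWeight π K m y ≤ ∑ y ∈ T, chainWeight π K m y +
        ∑ y with ∃ x, δ * (m + 1) < |(letterCount y x : ℝ) - (m + 1) * π x|,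
          chainWeight π K m y := by
      rw [← Finset.sum_union_inter]
      refine le_add_of_le_of_nonneg (Finset.sum_le_sum_of_subset_of_nonneg ?_
        fun y _ _ => h.chainWeight_nonneg m y)
        (Finset.sum_nonneg fun y _ => h.chainWeight_nonneg m y)
      intro y hy
      simp only [Finset.mem_union, Finset.mem_filter, Finset.mem_univ, true_and, hT] at hy ⊢
      by_cases hy' : ∃ x, δ * (m + 1) < |(letterCount y x : ℝ) - (m + 1) * π x|
      · exact Or.inr hy'
      · push Not at hy'
        exact Or.inl ⟨hy, letterCount_mem_nearCounts (by simpa using hy')⟩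
    linarith
  have hTπ : c / 2 / C ^ (m + 1) ≤ ∑ y ∈ T, ∏ i, π (y i) := by
    rw [div_le_iff₀' (by positivity), Finset.mul_sum]
    exact hTw.trans (Finset.sum_le_sum fun y _ => h.chainWeight_le hC hK m y)
  rw [← Finset.sum_fiberwise_of_maps_to (g := letterCount) (t := nearCounts π δ (m + 1))
    (fun y hy => (Finset.mem_filter.1 hy).2.2)] at hTπ
  set B : ℝ := (((m + 1 : ℕ) : ℝ) + 1) ^ Fintype.card X with hB
  have hB0 : 0 < B := by positivity
  set η := c / 2 / (C ^ (m + 1) * B) with hη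
  have hη0 : 0 < η := by positivity
  obtain ⟨d, hd, hdη⟩ : ∃ d ∈ nearCounts π δ (m + 1),
      η ≤ ∑ y ∈ T with letterCount y = d, ∏ i, π (y i) := by
    by_contra! hlt
    have h1 : ∑ d ∈ nearCounts π δ (m + 1), ∑ y ∈ T with letterCount y = d, ∏ i, π (y i) <
        B * η := by
      rcases (nearCounts π δ (m + 1)).eq_empty_or_nonempty with he | hne
      · rw [he, Finset.sum_empty]
        positivity
      · calc _ < ∑ d ∈ nearCounts π δ (m + 1), η := Finset.sum_lt_sum_of_nonempty hne hlt
          _ ≤ B * η := by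
            rw [Finset.sum_const, nsmul_eq_mul]
            exact mul_le_mul_of_nonneg_right (card_nearCounts_le _ _ _) hη0.le
    have h2 : B * η = c / 2 / C ^ (m + 1) := by
      rw [hη]
      field_simp
    linarith
  refine ⟨d, hd, ?_⟩
  set q : ℝ := ∏ x, π x ^ d x with hq
  have hq0 : 0 ≤ q := Finset.prod_nonneg fun x _ => pow_nonneg (h.init_nonneg x) _
  have hqy : ∀ y : Fin (m + 1) → X, letterCount y = d → ∏ i, π (y i) = q := fun y hy => by
    rw [prod_eq_prod_pow_letterCount, hy]
  have h1 : (Finset.univ.filter fun y : Fin (m + 1) → X => letterCount y = d).card * q ≤ 1 := by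
    rw [← nsmul_eq_mul, ← Finset.sum_const,
      ← Finset.sum_congr rfl fun y hy => hqy y (Finset.mem_filter.1 hy).2]
    refine (Finset.sum_le_sum_of_subset_of_nonneg (Finset.filter_subset _ _) fun y _ _ =>
      Finset.prod_nonneg fun i _ => h.init_nonneg _).trans_eq ?_
    rw [← Fintype.piFinset_univ, ← Finset.prod_univ_sum]
    simp [h.init_sum]
  have h2 : η ≤ (T.filter fun y => letterCount y = d).card * q := by
    refine hdη.trans_eq ?_
    rw [Finset.sum_congr rfl fun y hy => hqy y (Finset.mem_filter.1 hy).2, Finset.sum_const,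
      nsmul_eq_mul]
  have e1 : Nat.card (typeSet (Fin (m + 1)) d) =
      (Finset.univ.filter fun y : Fin (m + 1) → X => letterCount y = d).card := by
    rw [Nat.card_eq_fintype_card, ← Set.toFinset_card]
    congr 1
    ext y
    rw [Set.mem_toFinset, Finset.mem_filter, funext_iff]
    exact ⟨fun hy => ⟨Finset.mem_univ _, hy⟩, fun hy => hy.2⟩
  have e2 : Nat.card (S ∩ typeSet (Fin (m + 1)) d : Set (Fin (m + 1) → X)) =
      (T.filter fun y => letterCount y = d).card := by
    rw [Nat.card_eq_fintype_card, ← Set.toFinset_card]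
    congr 1
    ext y
    simp only [typeSet, Set.toFinset_inter, Finset.mem_inter, Set.mem_toFinset,
      Set.mem_ofPred_eq, Finset.mem_filter, Finset.mem_univ, true_and, hT, ← funext_iff]
    exact ⟨fun hy => ⟨⟨hy.1, hy.2 ▸ hd⟩, hy.2⟩, fun hy => ⟨hy.1.1, hy.2⟩⟩
  rw [e1, e2]
  set M : ℝ := ((Finset.univ.filter fun y : Fin (m + 1) → X => letterCount y = d).card : ℝ)
  have hM0 : 0 ≤ M := Nat.cast_nonneg _
  set L : ℝ := ((T.filter fun y => letterCount y = d).card : ℝ)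
  have hL0 : 0 ≤ L := Nat.cast_nonneg _
  calc η * M ≤ L * q * M := mul_le_mul_of_nonneg_right h2 hM0
    _ = L * (M * q) := by ring
    _ ≤ L * 1 := mul_le_mul_of_nonneg_left h1 hL0
    _ = L := mul_one L

open Classical in
/-- Every set of words with probability at least `c` has exponential rate at least that of `H`
at `π`, up to the logarithm of the density constant `C`. -/
theorem IsStationaryChain.eventually_le_logb {X : Type u} [Fintype X] {π : X → ℝ}
    {K : X → X → ℝ} (h : IsStationaryChain π K) {b : X}
    (hb : ∀ x, Relation.ReflTransGen (fun x y => 0 < K x y) x b) {C : ℝ} (hC : 1 ≤ C)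
    (hK : ∀ x y, K x y ≤ C * π y) {f : GraphParameter.{u}}
    (hf : IsSpectralPoint f) (H : SimpleGraph X) {c : ℝ} (hc0 : 0 < c) (hc1 : c < 1)
    {ε : ℝ} (hε : 0 < ε) :
    ∀ᶠ m : ℕ in atTop, ∀ S : Set (Fin (m + 1) → X), c ≤ ∑ y with y ∈ S, chainWeight π K m y →
      (m + 1) * (typeRate f H π - Real.logb 2 C - ε) ≤
        Real.logb 2 (f S ((powerGraph H (Fin (m + 1))).induce S)) := by
  have hC0 : 0 < C := one_pos.trans_le hC
  obtain ⟨δ, hδ, N, hN⟩ := hf.exists_abs_logType_sub_le H h.init_mem (half_pos hε)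
  have hX : (1 : ℝ) ≤ Nat.card X := by
    have : Nonempty X := ⟨b⟩
    exact_mod_cast Nat.card_pos
  have hlogX : 0 ≤ Real.log (Nat.card X) := Real.log_nonneg hX
  have hpoly := (tendsto_add_atTop_nat 1).eventually
    (eventually_mul_pow_le_rpow ((Real.log (Nat.card X) + 1) * (2 / c)) (Fintype.card X + 1)
      (half_pos hε))
  filter_upwards [(h.tendsto_sum_chainWeight_atypical hb hδ).eventually_lt_const (half_pos hc0),
    hpoly, eventually_ge_atTop N] with m hm hpoly hmN S hS
  obtain ⟨d, hd, hdS⟩ := h.exists_dense_typeSet hC hK hc0 hS hm.le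
  obtain ⟨hd1, hd2⟩ := mem_nearCounts hd
  have hcard : Nat.card (Fin (m + 1)) = ∑ x, d x := by rw [hd1, Nat.card_fin]
  have hSne : S.Nonempty := by
    by_contra hne
    rw [Set.not_nonempty_iff_eq_empty] at hne
    rw [hne] at hS
    simp at hS
    linarith
  have := hSne.to_subtype
  set n : ℝ := ((m + 1 : ℕ) : ℝ) with hn
  have hn0 : 0 < n := by positivity
  set B : ℝ := (n + 1) ^ Fintype.card X with hB
  have hB1 : 1 ≤ B := one_le_pow₀ (by linarith)
  set η := c / 2 / (C ^ (m + 1) * B) with hη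
  have hη0 : 0 < η := by positivity
  have hCn : 1 ≤ C ^ (m + 1) := one_le_pow₀ hC
  have hη1 : η ≤ 1 := by
    rw [hη, div_le_one (by positivity)]
    nlinarith
  have hne := typeSet_nonempty hcard
  have hdens := hf.typeValue_le_of_density H hne S hη0 hdS
  set v := f S ((powerGraph H (Fin (m + 1))).induce S) with hv
  have hv1 : 1 ≤ v := hf.one_le _
  have hv0 : 0 < v := one_pos.trans_le hv1
  have hlogT : Real.log (Nat.card (typeSet (Fin (m + 1)) d)) ≤ n * Real.log (Nat.card X) := by
    rw [hn, ← Real.log_pow]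
    have := hne.to_subtype
    refine Real.log_le_log (by exact_mod_cast Nat.card_pos) ?_
    have h1 : Nat.card (typeSet (Fin (m + 1)) d) ≤ Nat.card (Fin (m + 1) → X) :=
      Finite.card_subtype_le _
    rw [Nat.card_fun, Nat.card_fin] at h1
    exact_mod_cast h1
  have hfac : Real.log (Nat.card (typeSet (Fin (m + 1)) d)) / η + 1 ≤
      (Real.log (Nat.card X) + 1) * (2 / c) * (n + 1) ^ (Fintype.card X + 1) * C ^ (m + 1) := by
    calc Real.log (Nat.card (typeSet (Fin (m + 1)) d)) / η + 1
        ≤ n * Real.log (Nat.card X) / η + 1 / η :=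
          add_le_add (div_le_div_of_nonneg_right hlogT hη0.le) (by rwa [le_div_iff₀ hη0, one_mul])
      _ = (n * Real.log (Nat.card X) + 1) / η := by rw [add_div]
      _ ≤ (Real.log (Nat.card X) + 1) * (n + 1) / η :=
          div_le_div_of_nonneg_right (by nlinarith) hη0.le
      _ = _ := by
          rw [hη, pow_succ (n + 1), ← hB]
          field_simp
  have h1 : (2 : ℝ) ^ (n * (typeRate f H π - ε / 2)) ≤ typeValue f H (Fin (m + 1)) d := by
    rw [← Real.le_logb_iff_rpow_le one_lt_two (hf.typeValue_pos H hcard),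
      hf.logb_typeValue H hcard]
    have h3 := abs_le.1 (hN (m + 1) (by omega) d hd1 hd2)
    linarith [h3.1]
  have h2 : (2 : ℝ) ^ (n * (typeRate f H π - ε / 2)) ≤ 2 ^ (n * (ε / 2)) * C ^ (m + 1) * v :=
    h1.trans (hdens.trans (mul_le_mul_of_nonneg_right
      (hfac.trans (mul_le_mul_of_nonneg_right hpoly (by positivity))) hv0.le))
  have h3 := Real.logb_le_logb_of_le one_lt_two (by positivity) h2
  rw [Real.logb_mul (by positivity) hv0.ne', Real.logb_mul (by positivity) (by positivity),
    Real.logb_rpow two_pos (by norm_num), Real.logb_rpow two_pos (by norm_num), Real.logb_pow,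
    ← hn] at h3
  have hn' : ((m : ℝ) + 1) = n := by rw [hn]; push_cast; ring
  rw [hn']
  linarith

/-! ### The chain of blocks and its irreducibility -/

/-- The probability that a chain with transition matrix `W` continues the block `y` with the
block `z`; blocks have length `l + 1`. -/
noncomputable def blockKernel {V : Type*} (W : V → V → ℝ) (l : ℕ) (y z : Fin (l + 1) → V) : ℝ :=
  chainWeight (W (y (Fin.last l))) W l z

/-- The probability of the first `n + 1` letters of an infinite word. -/
noncomputable def pathWeight {V : Type*} (p : V → ℝ) (W : V → V → ℝ) (n : ℕ) (x : ℕ → V) : ℝ :=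
  p (x 0) * ∏ i ∈ Finset.range n, W (x i) (x (i + 1))

theorem chainWeight_eq_pathWeight {V : Type*} (p : V → ℝ) (W : V → V → ℝ) (n : ℕ) (x : ℕ → V) :
    chainWeight p W n (fun i => x i) = pathWeight p W n x := by
  rw [chainWeight, pathWeight, Finset.prod_range]
  rfl

/-- Cutting a word into blocks does not change its probability. -/
theorem chainWeight_blockKernel {V : Type*} (p : V → ℝ) (W : V → V → ℝ) (l m : ℕ) (x : ℕ → V) :
    chainWeight (chainWeight p W l) (blockKernel W l) m
      (fun j i => x (j * (l + 1) + i)) = pathWeight p W (m * (l + 1) + l) x := by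
  rw [chainWeight_eq_pathWeight (V := Fin (l + 1) → V) (chainWeight p W l) (blockKernel W l) m
    (fun j i => x (j * (l + 1) + i))]
  induction m with
  | zero =>
    simp only [pathWeight, Finset.range_zero, Finset.prod_empty, mul_one, zero_mul, zero_add]
    exact chainWeight_eq_pathWeight p W l x
  | succ m ih =>
    rw [pathWeight] at ih ⊢
    rw [Finset.prod_range_succ, ← mul_assoc, ih, pathWeight, pathWeight]
    have hlen : (m + 1) * (l + 1) + l = (m * (l + 1) + l) + (l + 1) := by ring
    rw [hlen, Finset.prod_range_add _ (m * (l + 1) + l) (l + 1), ← mul_assoc]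
    congr 2
    have h1 : blockKernel W l (fun i => x (m * (l + 1) + i)) (fun i => x ((m + 1) * (l + 1) + i)) =
        pathWeight (W (x (m * (l + 1) + l))) W l (fun i => x ((m + 1) * (l + 1) + i)) :=
      chainWeight_eq_pathWeight (W (x (m * (l + 1) + l))) W l
        (fun i => x ((m + 1) * (l + 1) + i))
    rw [h1, pathWeight, Finset.prod_range_succ']
    have h2 : ∀ i, (m + 1) * (l + 1) + i = m * (l + 1) + l + (i + 1) := fun i => by ring
    simp only [h2, zero_add]
    rw [mul_comm]
    rfl

theorem sum_chainWeight_of_stochastic {V : Type*} [Fintype V] (q : V → ℝ) {W : V → V → ℝ}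
    (hW : ∀ a, ∑ b, W a b = 1) (m : ℕ) : ∑ y, chainWeight q W m y = ∑ a, q a := by
  induction m with
  | zero =>
    rw [← (Equiv.funUnique (Fin 1) V).symm.sum_comp]
    exact Finset.sum_congr rfl fun x _ => by rw [chainWeight_zero]; rfl
  | succ m ih =>
    rw [sum_word_snoc, ← ih]
    refine Finset.sum_congr rfl fun y _ => ?_
    simp only [chainWeight_snoc, ← Finset.mul_sum, hW, mul_one]

theorem IsStationaryChain.blocks {V : Type*} [Fintype V] {p : V → ℝ} {W : V → V → ℝ}
    (h : IsStationaryChain p W) (l : ℕ) :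
    IsStationaryChain (chainWeight p W l) (blockKernel W l) where
  init_nonneg := h.chainWeight_nonneg l
  init_sum := h.sum_chainWeight l
  nonneg y z := mul_nonneg (h.nonneg _ _) (Finset.prod_nonneg fun _ _ => h.nonneg _ _)
  sum_eq_one y := (sum_chainWeight_of_stochastic _ h.sum_eq_one l).trans (h.sum_eq_one _)
  stationary z := by
    simp only [blockKernel, chainWeight.eq_1 (W _), ← mul_assoc]
    rw [← Finset.sum_mul, h.sum_chainWeight_last (fun a => W a (z 0)), h.stationary]
    rfl

theorem blockKernel_le {V : Type*} [Fintype V] {p : V → ℝ} {W : V → V → ℝ}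
    (h : IsStationaryChain p W) {C : ℝ} (hC : ∀ a b, W a b ≤ C * p b) (l : ℕ)
    (y z : Fin (l + 1) → V) : blockKernel W l y z ≤ C * chainWeight p W l z := by
  rw [blockKernel, chainWeight, chainWeight, ← mul_assoc]
  exact mul_le_mul_of_nonneg_right (hC _ _) (Finset.prod_nonneg fun _ _ => h.nonneg _ _)

/-- There is a walk of `n` transitions of positive probability from `a` to `b`. -/
def HasWalk {V : Type*} (W : V → V → ℝ) (n : ℕ) (a b : V) : Prop :=
  ∃ x : ℕ → V, x 0 = a ∧ x n = b ∧ ∀ i < n, 0 < W (x i) (x (i + 1))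

namespace HasWalk

variable {V : Type*} {W : V → V → ℝ}

theorem refl (a : V) : HasWalk W 0 a a := ⟨fun _ => a, rfl, rfl, fun _ h => absurd h (by simp)⟩

theorem single {a b : V} (h : 0 < W a b) : HasWalk W 1 a b :=
  ⟨fun i => if i = 0 then a else b, rfl, rfl, fun i hi => by
    obtain rfl : i = 0 := by omega
    exact h⟩

theorem trans {m n : ℕ} {a b c : V} (h₁ : HasWalk W m a b) (h₂ : HasWalk W n b c) :
    HasWalk W (m + n) a c := by
  obtain ⟨x, hx0, hxm, hx⟩ := h₁
  obtain ⟨y, hy0, hyn, hy⟩ := h₂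
  have hright : ∀ i, m ≤ i → (fun i => if i < m then x i else y (i - m)) i = y (i - m) :=
    fun i hi => if_neg (by omega)
  have hleft : ∀ i, i ≤ m → (fun i => if i < m then x i else y (i - m)) i = x i := fun i hi => by
    rcases hi.lt_or_eq with h | rfl
    · exact if_pos h
    · rw [hright _ le_rfl, Nat.sub_self, hy0, hxm]
  refine ⟨fun i => if i < m then x i else y (i - m), ?_, ?_, fun i hi => ?_⟩
  · rw [hleft 0 (Nat.zero_le _), hx0]
  · rw [hright _ (Nat.le_add_right _ _), Nat.add_sub_cancel_left, hyn]
  · rcases Nat.lt_or_ge i m with h | h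
    · rw [hleft i h.le, hleft (i + 1) h]
      exact hx i h
    · rw [hright i h, hright (i + 1) (by omega), Nat.sub_add_comm h]
      exact hy _ (by omega)

theorem mul_left {n : ℕ} {a : V} (h : HasWalk W n a a) (j : ℕ) : HasWalk W (n * j) a a := by
  induction j with
  | zero => exact refl a
  | succ j ih => exact ih.trans h

theorem of_transGen {a b : V} (h : Relation.TransGen (fun x y => 0 < W x y) a b) :
    ∃ n, 0 < n ∧ HasWalk W n a b := by
  induction h with
  | single h => exact ⟨1, one_pos, single h⟩
  | tail _ h ih =>
    obtain ⟨n, hn, hw⟩ := ih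
    exact ⟨n + 1, Nat.succ_pos n, hw.trans (single h)⟩

end HasWalk

/-- A stationary chain that never leaves the support of its distribution and is irreducible
there. -/
structure IsIrreducibleChain {V : Type*} [Fintype V] (p : V → ℝ) (W : V → V → ℝ) : Prop
    extends IsStationaryChain p W where
  support : ∀ a b, 0 < W a b → 0 < p b
  irreducible : ∀ a b, 0 < p a → 0 < p b → Relation.TransGen (fun x y => 0 < W x y) a b

namespace IsIrreducibleChain

variable {V : Type*} [Fintype V] {p : V → ℝ} {W : V → V → ℝ}

/-- A common multiple of the lengths of closed walks through all letters of the support. -/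
theorem exists_return_length (h : IsIrreducibleChain p W) :
    ∃ D, 0 < D ∧ ∀ a, 0 < p a → ∀ j, HasWalk W (D * j) a a := by
  have hr : ∀ a, ∃ n, 0 < n ∧ (0 < p a → HasWalk W n a a) := by
    intro a
    by_cases ha : 0 < p a
    · obtain ⟨n, hn, hw⟩ := HasWalk.of_transGen (h.irreducible a a ha ha)
      exact ⟨n, hn, fun _ => hw⟩
    · exact ⟨1, one_pos, fun h => absurd h ha⟩
  choose r hr0 hr using hr
  refine ⟨∏ a, r a, Finset.prod_pos fun a _ => hr0 a, fun a ha j => ?_⟩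
  obtain ⟨q, hq⟩ := Finset.dvd_prod_of_mem r (Finset.mem_univ a)
  rw [hq, mul_assoc]
  exact (hr a ha).mul_left _

/-- For blocks of length `D j + 1` all transitions of the letter chain are also possible in one
block step, so the block chain inherits irreducibility whatever the period is. -/
theorem exists_reachable_block (h : IsIrreducibleChain p W) {D : ℕ}
    (hD : ∀ a, 0 < p a → ∀ j, HasWalk W (D * j) a a) (j : ℕ) :
    ∃ z : Fin (D * j + 1) → V, ∀ y,
      Relation.ReflTransGen (fun y y' => 0 < blockKernel W (D * j) y y') y z := by
  set l := D * j with hl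
  have hpos : ∀ (y : Fin (l + 1) → V) (x : ℕ → V), 0 < W (y (Fin.last l)) (x 0) →
      (∀ i < l, 0 < W (x i) (x (i + 1))) → 0 < blockKernel W l y (fun i => x i) := by
    intro y x h0 hx
    rw [blockKernel, chainWeight_eq_pathWeight]
    exact mul_pos h0 (Finset.prod_pos fun i hi => hx i (Finset.mem_range.1 hi))
  have hnext : ∀ a, ∃ b, 0 < W a b := by
    intro a
    by_contra! hle
    have := Finset.sum_nonpos fun b (_ : b ∈ Finset.univ) => hle b
    rw [h.sum_eq_one] at this
    linarith
  obtain ⟨b, hb⟩ : ∃ b, 0 < p b := by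
    by_contra! hle
    have := Finset.sum_nonpos fun b (_ : b ∈ Finset.univ) => hle b
    rw [h.init_sum] at this
    linarith
  have hreach : ∀ (y : Fin (l + 1) → V) (a c : V), 0 < W (y (Fin.last l)) a →
      Relation.ReflTransGen (fun x y => 0 < W x y) a c →
      ∃ y', Relation.ReflTransGen (fun y y' => 0 < blockKernel W l y y') y y' ∧
        0 < W (y' (Fin.last l)) c := by
    intro y a c hya hac
    induction hac with
    | refl => exact ⟨y, Relation.ReflTransGen.refl, hya⟩
    | @tail c d _ hcd ih =>
      obtain ⟨y', hyy', hy'c⟩ := ih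
      obtain ⟨x, hx0, hxl, hx⟩ := (HasWalk.single hcd).trans (hD d (h.support c d hcd) j)
      rw [← hl, add_comm] at hxl hx
      refine ⟨fun i => x i, hyy'.tail (hpos y' x (hx0 ▸ hy'c) fun i hi => hx i (by omega)), ?_⟩
      have := hx l (Nat.lt_succ_self l)
      rwa [hxl] at this
  obtain ⟨x, hx0, _, hx⟩ := hD b hb j
  refine ⟨fun i => x i, fun y => ?_⟩
  obtain ⟨a, ha⟩ := hnext (y (Fin.last l))
  obtain ⟨y', hyy', hy'b⟩ := hreach y a b ha
    (h.irreducible a b (h.support _ _ ha) hb).to_reflTransGen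
  exact hyy'.tail (hpos y' x (hx0 ▸ hy'b) hx)

/-- The transition matrix is dominated by a multiple of the stationary distribution. -/
theorem exists_le_mul (h : IsIrreducibleChain p W) :
    ∃ C : ℝ, 1 ≤ C ∧ ∀ a b, W a b ≤ C * p b := by
  have hinv : ∀ b, 0 ≤ (p b)⁻¹ := fun b => inv_nonneg.2 (h.init_nonneg b)
  refine ⟨1 + ∑ b, (p b)⁻¹, le_add_of_nonneg_right (Finset.sum_nonneg fun b _ => hinv b),
    fun a b => ?_⟩
  rcases (h.nonneg a b).eq_or_lt with h0 | hab
  · rw [← h0]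
    exact mul_nonneg (add_nonneg zero_le_one (Finset.sum_nonneg fun b _ => hinv b))
      (h.init_nonneg b)
  · have hb := h.support a b hab
    have h1 : W a b ≤ 1 := by
      rw [← h.sum_eq_one a]
      exact Finset.single_le_sum (fun b _ => h.nonneg a b) (Finset.mem_univ b)
    have h2 : (p b)⁻¹ ≤ 1 + ∑ b, (p b)⁻¹ :=
      (Finset.single_le_sum (fun b _ => hinv b) (Finset.mem_univ b)).trans
        (le_add_of_nonneg_left zero_le_one)
    calc W a b ≤ (p b)⁻¹ * p b := by rwa [inv_mul_cancel₀ hb.ne']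
      _ ≤ _ := mul_le_mul_of_nonneg_right h2 hb.le

end IsIrreducibleChain

/-- The value of `transition` at letters of probability zero keeps the chain in the support of the
first marginal. -/
theorem IsIrreducibleStationary.isIrreducibleChain {V : Type u} [Fintype V]
    {P : stdSimplex ℝ (V × V)} (hP : IsIrreducibleStationary P) :
    IsIrreducibleChain (fun a => fstMarginal P a) (fun a b => transition P a b) := by
  have hP0 : ∀ q, 0 ≤ P q := P.2.1
  have hfst : ∀ a, fstMarginal P a = ∑ b, P (a, b) := fun a => rfl
  have hfst0 : ∀ a, 0 ≤ fstMarginal P a := (fstMarginal P).2.1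
  have htr : ∀ a b, fstMarginal P a ≠ 0 → transition P a b = P (a, b) / fstMarginal P a := by
    intro a b ha
    rw [transition, dif_neg ha]
    rfl
  have htr0 : ∀ a b, fstMarginal P a = 0 → transition P a b = fstMarginal P b := by
    intro a b ha
    rw [transition, dif_pos ha]
  have hle1 : ∀ a b, P (a, b) ≤ fstMarginal P a := fun a b =>
    Finset.single_le_sum (f := fun b => P (a, b)) (fun _ _ => hP0 _) (Finset.mem_univ b)
  have hle2 : ∀ a b, P (a, b) ≤ fstMarginal P b := fun a b => by
    rw [hfst, hP.marginals_eq]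
    exact Finset.single_le_sum (f := fun a => P (a, b)) (fun _ _ => hP0 _) (Finset.mem_univ a)
  have hmul : ∀ a b, fstMarginal P a * transition P a b = P (a, b) := by
    intro a b
    by_cases ha : fstMarginal P a = 0
    · rw [ha, zero_mul]
      exact le_antisymm (hP0 _) ((hle1 a b).trans_eq ha)
    · rw [htr a b ha, mul_div_cancel₀ _ ha]
  exact
  { init_nonneg := hfst0
    init_sum := stdSimplex.sum_eq_one _
    nonneg := fun a b => (transition P a).2.1 b
    sum_eq_one := fun a => stdSimplex.sum_eq_one _
    stationary := fun b => by simp only [hmul, ← hP.marginals_eq]; rfl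
    support := fun a b hab => by
      by_cases ha : fstMarginal P a = 0
      · rwa [htr0 a b ha] at hab
      · rw [htr a b ha] at hab
        have := (div_pos_iff_of_pos_right ((hfst0 a).lt_of_ne' ha)).1 hab
        exact this.trans_le (hle2 a b)
    irreducible := fun a b ha hb => Relation.TransGen.mono (fun x y hxy => by
      have hx := hxy.trans_le (hle1 x y)
      rw [htr x y hx.ne']
      exact div_pos hxy hx) _ _ (hP.irreducible a b ha hb) }

/-! ### Monotonicity of the rate under projections -/

theorem letterCount_comp {A B ι : Type*} [Fintype A] [DecidableEq B] [Finite ι] (φ : A → B)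
    (x : ι → A) (b : B) : letterCount (φ ∘ x) b = ∑ a with φ a = b, letterCount x a := by
  classical
  have := Fintype.ofFinite ι
  simp only [letterCount, Nat.card_eq_fintype_card, Fintype.card_subtype]
  rw [Finset.card_eq_sum_card_fiberwise (f := x) (t := Finset.univ.filter fun a => φ a = b)
    (fun i hi => by simpa using hi)]
  refine Finset.sum_congr rfl fun a ha => congrArg Finset.card ?_
  ext i
  simp only [Finset.mem_filter, Finset.mem_univ, true_and, Function.comp] at ha ⊢
  exact ⟨fun h => h.2, fun h => ⟨by rw [h, ha], h⟩⟩

namespace IsSpectralPoint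

variable {f : GraphParameter.{u}}

/-- Type classes project onto type classes. -/
theorem typeValue_map_le (hf : IsSpectralPoint f) {A B : Type u} [Fintype A] [Finite B]
    [DecidableEq B] {H : SimpleGraph A} {K : SimpleGraph B} (φ : A → B)
    (h : ∀ a a', Confusable H a a' → Confusable K (φ a) (φ a')) {ι : Type} [Finite ι] {c : A → ℕ}
    (hc : Nat.card ι = ∑ a, c a) :
    typeValue f K ι (fun b => ∑ a with φ a = b, c a) ≤ typeValue f H ι c := by
  refine le_trans (hf.induce_mono (powerGraph K ι) ?_) (hf.image_le (H := powerGraph H ι)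
    (K := powerGraph K ι) (fun x => φ ∘ x) (fun x y hxy => ?_) (typeSet ι c))
  · intro w hw
    obtain ⟨x, hx⟩ := typeSet_nonempty hc
    obtain ⟨σ, hσ⟩ := exists_perm_of_letterCount_eq (x := φ ∘ x) (y := w) fun b => by
      rw [letterCount_comp, hw b]
      exact Finset.sum_congr rfl fun a _ => hx a
    exact ⟨x ∘ σ, fun a => by rw [letterCount_comp_equiv, hx a], hσ⟩
  · rw [confusable_powerGraph] at hxy ⊢
    exact fun i => h _ _ (hxy i)

theorem typeRate_map_le (hf : IsSpectralPoint f) {A B : Type u} [Fintype A] [Fintype B]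
    [DecidableEq B] {H : SimpleGraph A} {K : SimpleGraph B} (φ : A → B)
    (h : ∀ a a', Confusable H a a' → Confusable K (φ a) (φ a')) (P : stdSimplex ℝ A)
    (Q : stdSimplex ℝ B) (hQ : ∀ b, Q b = ∑ a with φ a = b, P a) :
    typeRate f K Q ≤ typeRate f H P := by
  obtain ⟨R, hR, hRP⟩ := exists_nTypes_tendsto P
  have hpush : ∀ T : stdSimplex ℝ A, (fun b => ∑ a with φ a = b, T a) ∈ stdSimplex ℝ B :=
    fun T => ⟨fun b => Finset.sum_nonneg fun a _ => T.2.1 a, by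
      rw [Finset.sum_fiberwise]
      exact stdSimplex.sum_eq_one T⟩
  set R' : ℕ → stdSimplex ℝ B := fun n => ⟨_, hpush (R n)⟩ with hR'
  have hR'c : ∀ (n : ℕ) (c : A → ℕ), (∀ a, (n : ℝ) * R n a = c a) →
      ∀ b, (n : ℝ) * R' n b = ((∑ a with φ a = b, c a : ℕ) : ℝ) := fun n c hc b => by
    rw [Nat.cast_sum, ← Finset.sum_congr rfl fun a _ => hc a, ← Finset.mul_sum]
    rfl
  have hR'n : ∀ n, IsNType n (R' n) := fun n b => by
    choose c hc using hR n
    exact ⟨_, hR'c n c hc b⟩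
  have hR'Q : Tendsto R' atTop (𝓝 Q) := by
    rw [tendsto_stdSimplex_iff] at hRP ⊢
    intro b
    rw [hQ b]
    exact tendsto_finsetSum _ fun a _ => hRP a
  refine le_of_tendsto_of_tendsto' (hf.isProbabilisticRefinement B K Q R' hR'n hR'Q)
    (hf.isProbabilisticRefinement A H P R hR hRP) fun n => ?_
  choose c hc using hR n
  have hcard : Nat.card (Fin n) = ∑ a, c a := by rw [sum_of_nType hc, Nat.card_fin]
  have hcard' : Nat.card (Fin n) = ∑ b, ∑ a with φ a = b, c a := by
    rw [Finset.sum_fiberwise, hcard]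
  rw [value_typeGraph f H hc, value_typeGraph f K (hR'c n c hc)]
  exact mul_le_mul_of_nonneg_left (Real.logb_le_logb_of_le one_lt_two
    (hf.typeValue_pos K hcard') (hf.typeValue_map_le φ h hcard)) (by positivity)

theorem typeRate_nonneg (hf : IsSpectralPoint f) {V : Type u} [Fintype V] (G : SimpleGraph V)
    {P : V → ℝ} (hP : P ∈ stdSimplex ℝ V) : 0 ≤ typeRate f G P :=
  ge_of_tendsto' (hf.tendsto_typeRate G hP) fun _ =>
    div_nonneg (hf.logType_nonneg G _) (Nat.cast_nonneg _)

/-- The `F`-value of the marginals of a source on its strong powers increases with the length. -/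
theorem monotone_typeRate_blockLaw (hf : IsSpectralPoint f) {V : Type u} [Fintype V]
    [MeasurableSpace V] [DiscreteMeasurableSpace V] (G : SimpleGraph V) (μ : Measure (ℕ → V))
    [IsProbabilityMeasure μ] :
    Monotone fun n => typeRate f (strongPower G n) (probVector (blockLaw μ n)) := by
  classical
  intro m n hmn
  refine hf.typeRate_map_le (fun x i => x (Fin.castLE hmn i)) (fun x y hxy => ?_) _ _ fun b => ?_
  · rw [confusable_strongPower] at hxy ⊢
    exact fun i => hxy _
  · change (blockLaw μ m).real {b} = ∑ a with _ = b, (blockLaw μ n).real {a}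
    rw [sum_measureReal_singleton, blockLaw, blockLaw,
      map_measureReal_apply (measurable_initialBlock m) (Set.toFinite _).measurableSet,
      map_measureReal_apply (measurable_initialBlock n) (Set.toFinite _).measurableSet]
    congr 1
    ext ω
    simp only [Set.mem_preimage, Set.mem_singleton_iff, Finset.coe_filter, Finset.mem_univ,
      true_and, Set.mem_ofPred_eq]
    exact Iff.rfl

end IsSpectralPoint

/-! ### Block laws of the Markov measure -/

section Markov

variable {V : Type u} [Fintype V] [MeasurableSpace V] [DiscreteMeasurableSpace V]

/-- The first `m + 1` blocks of length `l + 1` of an infinite word. -/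
def wordBlocks {V : Type*} (l m : ℕ) (ω : ℕ → V) : Fin (m + 1) → Fin (l + 1) → V :=
  fun j i => ω (j * (l + 1) + i)

theorem wordBlocks_surjective {V : Type*} (l m : ℕ) :
    Function.Surjective (wordBlocks (V := V) l m) := by
  intro y
  refine ⟨fun n => y (Fin.ofNat (m + 1) (n / (l + 1))) (Fin.ofNat (l + 1) n), ?_⟩
  funext j i
  have h1 : (j * (l + 1) + i : ℕ) / (l + 1) = j := by
    rw [mul_comm, Nat.mul_add_div (Nat.succ_pos l), Nat.div_eq_of_lt i.2, add_zero]
  have h2 : (j * (l + 1) + i : ℕ) % (l + 1) = i := by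
    rw [mul_comm, Nat.mul_add_mod, Nat.mod_eq_of_lt i.2]
  have e1 : Fin.ofNat (m + 1) ((j * (l + 1) + i : ℕ) / (l + 1)) = j := by
    rw [h1]
    exact Fin.ofNat_val_eq_self j
  have e2 : Fin.ofNat (l + 1) (j * (l + 1) + i) = i := Fin.ext h2
  rw [wordBlocks, e1, e2]

theorem wordBlocks_eq_iff {V : Type*} {l m : ℕ} {ω x : ℕ → V} :
    wordBlocks l m ω = wordBlocks l m x ↔ ∀ n ≤ m * (l + 1) + l, ω n = x n := by
  constructor
  · intro h n hn
    have h1 : n / (l + 1) < m + 1 := by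
      rw [Nat.div_lt_iff_lt_mul (Nat.succ_pos l)]
      linarith
    have h2 := congrFun (congrFun h ⟨n / (l + 1), h1⟩) ⟨n % (l + 1), Nat.mod_lt _ (Nat.succ_pos l)⟩
    simpa only [wordBlocks, Nat.div_add_mod'] using h2
  · intro h
    funext j i
    refine h _ ?_
    have := Nat.mul_le_mul_right (l + 1) (Nat.le_of_lt_succ j.2)
    have := Nat.le_of_lt_succ i.2
    omega

theorem measurable_wordBlocks {V : Type*} [MeasurableSpace V] (l m : ℕ) :
    Measurable (wordBlocks (V := V) l m) :=
  measurable_pi_lambda _ fun _ => measurable_pi_lambda _ fun _ => measurable_pi_apply _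

theorem markovMeasure_real_cylinder (P : stdSimplex ℝ (V × V)) (x : ℕ → V) (n : ℕ) :
    (markovMeasure P).real {ω | ∀ i ≤ n, ω i = x i} =
      pathWeight (fun a => fstMarginal P a) (fun a b => transition P a b) n x := by
  rw [Measure.real, markovMeasure_cylinder, ENNReal.toReal_ofReal]
  · rfl
  · exact mul_nonneg ((fstMarginal P).2.1 _)
      (Finset.prod_nonneg fun i _ => (transition P (x i)).2.1 _)

theorem probVector_markovMeasure (P : stdSimplex ℝ (V × V)) (l : ℕ) :
    (fun y => probVector (blockLaw (markovMeasure P) (l + 1)) y) =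
      chainWeight (fun a => fstMarginal P a) (fun a b => transition P a b) l := by
  funext y
  change (blockLaw (markovMeasure P) (l + 1)).real {y} = _
  rw [blockLaw, map_measureReal_apply (measurable_initialBlock _) (Set.toFinite _).measurableSet]
  obtain ⟨x, rfl⟩ : ∃ x : ℕ → V, (fun i : Fin (l + 1) => x i) = y :=
    ⟨fun n => y (Fin.ofNat (l + 1) n), funext fun i => congrArg y (Fin.ofNat_val_eq_self i)⟩
  rw [chainWeight_eq_pathWeight, ← markovMeasure_real_cylinder]
  congr 1
  ext ω
  simp only [Set.mem_preimage, Set.mem_singleton_iff, funext_iff, initialBlock, Set.mem_ofPred_eq]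
  exact ⟨fun h i hi => h ⟨i, Nat.lt_succ_of_le hi⟩, fun h i => h i (Nat.le_of_lt_succ i.2)⟩

open Classical in
theorem markovMeasure_real_wordBlocks (P : stdSimplex ℝ (V × V)) (l m : ℕ)
    (S : Set (Fin (m + 1) → Fin (l + 1) → V)) :
    (markovMeasure P).real (wordBlocks l m ⁻¹' S) = ∑ y with y ∈ S,
      chainWeight (chainWeight (fun a => fstMarginal P a) (fun a b => transition P a b) l)
        (blockKernel (fun a b => transition P a b) l) m y := by
  have h1 : ∀ y, chainWeight (chainWeight (fun a => fstMarginal P a)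
      (fun a b => transition P a b) l) (blockKernel (fun a b => transition P a b) l) m y =
      ((markovMeasure P).map (wordBlocks l m)).real {y} := by
    intro y
    obtain ⟨x, rfl⟩ := wordBlocks_surjective l m y
    rw [map_measureReal_apply (measurable_wordBlocks l m) (Set.toFinite _).measurableSet]
    refine (chainWeight_blockKernel _ _ l m x).trans ?_
    rw [← markovMeasure_real_cylinder]
    congr 1
    ext ω
    exact wordBlocks_eq_iff.symm
  have := Measure.isProbabilityMeasure_map (μ := markovMeasure P)
    (measurable_wordBlocks l m).aemeasurable
  rw [Finset.sum_congr rfl fun y _ => h1 y, sum_measureReal_singleton,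
    map_measureReal_apply (measurable_wordBlocks l m) (Set.toFinite _).measurableSet]
  simp

end Markov

/-! ### Rates of the Markov source -/

section Rates

variable {V : Type u} [Fintype V] [MeasurableSpace V] [DiscreteMeasurableSpace V]

/-- The upper bound on the optimal rate: the first `n` letters of the typical sequences of
`n / k + 1` blocks of length `k = D j + 1`. -/
theorem IsSpectralPoint.eventually_minRate_le {f : GraphParameter.{u}} (hf : IsSpectralPoint f)
    (G : SimpleGraph V) {P : stdSimplex ℝ (V × V)} {D : ℕ}
    (hP : IsIrreducibleChain (fun a => fstMarginal P a) (fun a b => transition P a b))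
    (hD : ∀ a, 0 < fstMarginal P a → ∀ j, HasWalk (fun a b => transition P a b) (D * j) a a)
    (j : ℕ) {c : ℝ} (hc0 : 0 < c) (hc1 : c < 1) {ε : ℝ} (hε : 0 < ε) :
    ∀ᶠ n : ℕ in atTop, minRate f G (markovMeasure P) c n ≤
      typeRate f (strongPower G (D * j + 1)) (probVector (blockLaw (markovMeasure P) (D * j + 1))) /
        (D * j + 1 : ℕ) + ε := by
  classical
  set l := D * j with hl
  obtain ⟨z, hz⟩ := hP.exists_reachable_block hD j
  set R := typeRate f (strongPower G (l + 1)) (probVector (blockLaw (markovMeasure P) (l + 1)))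
    with hR
  have hR0 : 0 ≤ R := hf.typeRate_nonneg _ (probVector (blockLaw (markovMeasure P) (l + 1))).2
  have hRc : R = typeRate f (strongPower G (l + 1)) (chainWeight (fun a => fstMarginal P a)
      (fun a b => transition P a b) l) := by
    rw [hR, ← probVector_markovMeasure]
  have h1 := (hP.toIsStationaryChain.blocks l).eventually_exists_set hz hf (strongPower G (l + 1))
    hc0 hc1 (half_pos hε)
  rw [← hRc] at h1
  have h2 := (Nat.tendsto_div_const_atTop (n := l + 1) (Nat.succ_ne_zero l)).eventually h1
  have h3 : ∀ᶠ n : ℕ in atTop, R + ε / 2 ≤ ε / 2 * (n : ℝ) :=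
    (tendsto_natCast_atTop_atTop.const_mul_atTop (half_pos hε)).eventually_ge_atTop _
  filter_upwards [h2, h3, eventually_gt_atTop 0] with n hn hn' hn0
  obtain ⟨m, hm⟩ : ∃ m, m = n / (l + 1) := ⟨_, rfl⟩
  rw [← hm] at hn
  obtain ⟨S, hSc, hS⟩ := hn
  have hnm : ∀ i : Fin n, (i : ℕ) / (l + 1) < m + 1 := fun i =>
    Nat.lt_succ_of_le (hm ▸ Nat.div_le_div_right i.2.le)
  -- The first `n` letters of a word of `m + 1` blocks.
  set flat : (Fin (m + 1) → Fin (l + 1) → V) → Fin n → V := fun y i =>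
    y ⟨i / (l + 1), hnm i⟩ ⟨i % (l + 1), Nat.mod_lt _ (Nat.succ_pos l)⟩ with hflat
  have hprob : c ≤ (blockLaw (markovMeasure P) n).real (flat '' S) := by
    rw [← markovMeasure_real_wordBlocks] at hSc
    rw [blockLaw, map_measureReal_apply (measurable_initialBlock n) (Set.toFinite _).measurableSet]
    refine hSc.trans (measureReal_mono fun ω hω => ⟨_, hω, ?_⟩)
    funext i
    simp only [hflat, wordBlocks, initialBlock, Nat.div_add_mod']
  have hne : Nonempty (flat '' S) := by
    by_contra he
    rw [Set.nonempty_coe_sort, Set.not_nonempty_iff_eq_empty] at he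
    rw [he, measureReal_empty] at hprob
    linarith
  have hle := hf.image_le (H := powerGraph (strongPower G (l + 1)) (Fin (m + 1)))
    (K := strongPower G n) flat (fun x y hxy => by
      rw [confusable_powerGraph] at hxy
      rw [confusable_strongPower]
      exact fun i => confusable_strongPower.1 (hxy _) _) S
  have hlog := (Real.logb_le_logb_of_le one_lt_two (zero_lt_one.trans_le (hf.one_le _)) hle).trans
    hS
  refine ((minRate_isLeast f G (markovMeasure P) hc1.le n).2 ⟨_, hprob, rfl⟩).trans ?_
  have hn0' : (0 : ℝ) < n := by exact_mod_cast hn0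
  have hml : ((m : ℝ) + 1) ≤ n / (l + 1 : ℕ) + 1 := by
    have := Nat.cast_div_le (α := ℝ) (m := n) (n := l + 1)
    rw [hm]
    linarith
  calc 1 / (n : ℝ) * Real.logb 2 (f _ ((strongPower G n).induce (flat '' S)))
      ≤ 1 / n * ((n / (l + 1 : ℕ) + 1) * (R + ε / 2)) := by
        refine mul_le_mul_of_nonneg_left (hlog.trans ?_) (by positivity)
        exact mul_le_mul_of_nonneg_right hml (by positivity)
    _ = R / (l + 1 : ℕ) + ε / 2 / (l + 1 : ℕ) + (R + ε / 2) / n := by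
        field_simp
    _ ≤ R / (l + 1 : ℕ) + ε / 2 + ε / 2 := by
        refine add_le_add (add_le_add le_rfl ?_) ?_
        · exact div_le_self (half_pos hε).le (by exact_mod_cast Nat.succ_pos l)
        · rwa [div_le_iff₀ hn0']
    _ = _ := by ring

/-- The lower bound on the optimal rate: a set of words of length `n` does not lose probability,
and does not gain value, when only the first `n / k` blocks of length `k = D j + 1` are kept. -/
theorem IsSpectralPoint.eventually_le_minRate {f : GraphParameter.{u}} (hf : IsSpectralPoint f)
    (G : SimpleGraph V) {P : stdSimplex ℝ (V × V)} {D : ℕ}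
    (hP : IsIrreducibleChain (fun a => fstMarginal P a) (fun a b => transition P a b))
    (hD : ∀ a, 0 < fstMarginal P a → ∀ j, HasWalk (fun a b => transition P a b) (D * j) a a)
    {C : ℝ} (hC1 : 1 ≤ C) (hC : ∀ a b, transition P a b ≤ C * fstMarginal P b)
    (j : ℕ) {c : ℝ} (hc0 : 0 < c) (hc1 : c < 1) {ε : ℝ} (hε : 0 < ε) :
    ∀ᶠ n : ℕ in atTop,
      typeRate f (strongPower G (D * j + 1)) (probVector (blockLaw (markovMeasure P) (D * j + 1))) /
        (D * j + 1 : ℕ) - Real.logb 2 C / (D * j + 1 : ℕ) - ε ≤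
        minRate f G (markovMeasure P) c n := by
  classical
  set l := D * j with hl
  obtain ⟨z, hz⟩ := hP.exists_reachable_block hD j
  set R := typeRate f (strongPower G (l + 1)) (probVector (blockLaw (markovMeasure P) (l + 1)))
    with hR
  have hRc : R = typeRate f (strongPower G (l + 1)) (chainWeight (fun a => fstMarginal P a)
      (fun a b => transition P a b) l) := by
    rw [hR, ← probVector_markovMeasure]
  have h1 := (hP.toIsStationaryChain.blocks l).eventually_le_logb hz hC1
    (blockKernel_le hP.toIsStationaryChain hC l) hf (strongPower G (l + 1)) hc0 hc1 (half_pos hε)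
  rw [← hRc] at h1
  have h2 := ((tendsto_sub_atTop_nat 1).comp
    (Nat.tendsto_div_const_atTop (n := l + 1) (Nat.succ_ne_zero l))).eventually h1
  set A := R - Real.logb 2 C - ε / 2 with hA
  have h3 : ∀ᶠ n : ℕ in atTop, |A| ≤ ε / 2 * (n : ℝ) :=
    (tendsto_natCast_atTop_atTop.const_mul_atTop (half_pos hε)).eventually_ge_atTop _
  filter_upwards [h2, h3, eventually_ge_atTop (l + 1)] with n hn hn' hnl
  simp only [Function.comp] at hn
  set m := n / (l + 1) - 1 with hm
  have hm1 : m + 1 = n / (l + 1) := by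
    have : 1 ≤ n / (l + 1) := (Nat.one_le_div_iff (Nat.succ_pos l)).2 hnl
    omega
  have hmn : (m + 1) * (l + 1) ≤ n := by
    rw [hm1]
    exact Nat.div_mul_le_self n (l + 1)
  have hidx : ∀ (i : Fin (m + 1)) (k : Fin (l + 1)), (i * (l + 1) + k : ℕ) < n := by
    intro i k
    have h4 := Nat.mul_le_mul_right (l + 1) (Nat.succ_le_of_lt i.2)
    have h5 := k.2
    rw [Nat.succ_mul] at h4
    omega
  obtain ⟨⟨S, hSc, hS⟩, _⟩ := minRate_isLeast f G (markovMeasure P) hc1.le n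
  rw [hS]
  -- The first `m + 1` blocks of a word of length `n`.
  set cut : (Fin n → V) → Fin (m + 1) → Fin (l + 1) → V := fun x i k => x ⟨_, hidx i k⟩ with hcut
  have hprob : c ≤ (markovMeasure P).real (wordBlocks l m ⁻¹' (cut '' S)) := by
    rw [blockLaw, map_measureReal_apply (measurable_initialBlock n)
      (Set.toFinite _).measurableSet] at hSc
    exact hSc.trans (measureReal_mono fun ω hω => ⟨_, hω, rfl⟩)
  have hne : Nonempty (cut '' S) := by
    by_contra he
    rw [Set.nonempty_coe_sort, Set.not_nonempty_iff_eq_empty] at he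
    rw [he, Set.preimage_empty, measureReal_empty] at hprob
    linarith
  rw [markovMeasure_real_wordBlocks] at hprob
  have hle := hf.image_le (H := strongPower G n)
    (K := powerGraph (strongPower G (l + 1)) (Fin (m + 1))) cut (fun x y hxy => by
      rw [confusable_strongPower] at hxy
      rw [confusable_powerGraph]
      exact fun i => confusable_strongPower.2 fun k => hxy _) S
  have hlog := (hn _ hprob).trans
    (Real.logb_le_logb_of_le one_lt_two (zero_lt_one.trans_le (hf.one_le _)) hle)
  have hn0 : (0 : ℝ) < n := by
    have : 0 < n := by omega
    exact_mod_cast this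
  have hl0 : (0 : ℝ) < (l + 1 : ℕ) := by exact_mod_cast Nat.succ_pos l
  have hm2 : ((m : ℝ) + 1) ≤ n / (l + 1 : ℕ) := by
    rw [le_div_iff₀ hl0]
    exact_mod_cast hmn
  have hm3 : n / (l + 1 : ℕ) - 1 ≤ ((m : ℝ) + 1) := by
    have h6 : n < (m + 1 + 1) * (l + 1) := by
      rw [hm1]
      exact Nat.lt_mul_of_div_lt (Nat.lt_succ_self _) (Nat.succ_pos l)
    have h7 : (n : ℝ) < ((m : ℝ) + 1 + 1) * (l + 1 : ℕ) := by exact_mod_cast h6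
    rw [sub_le_iff_le_add, div_le_iff₀ hl0]
    exact h7.le
  -- The sign of `A` is unknown, so the rounding error is bounded with `|A|`.
  have hA1 : n / (l + 1 : ℕ) * A - |A| ≤ (m + 1) * A := by
    have h8 : |(n / (l + 1 : ℕ) - (m + 1)) * A| ≤ 1 * |A| := by
      rw [abs_mul]
      refine mul_le_mul_of_nonneg_right ?_ (abs_nonneg A)
      rw [abs_le]
      constructor <;> linarith
    have h9 := (abs_le.1 h8).2
    linarith
  calc R / (l + 1 : ℕ) - Real.logb 2 C / (l + 1 : ℕ) - ε
      ≤ R / (l + 1 : ℕ) - Real.logb 2 C / (l + 1 : ℕ) - ε / 2 / (l + 1 : ℕ) - |A| / n := by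
        have h10 : ε / 2 / (l + 1 : ℕ) ≤ ε / 2 :=
          div_le_self (half_pos hε).le (by exact_mod_cast Nat.succ_pos l)
        have h11 : |A| / n ≤ ε / 2 := by rwa [div_le_iff₀ hn0]
        linarith
    _ = 1 / n * (n / (l + 1 : ℕ) * A - |A|) := by
        rw [hA]
        field_simp
    _ ≤ _ := mul_le_mul_of_nonneg_left (hA1.trans hlog) (by positivity)

end Rates

/-- If `R` is monotone and the sequences `a c` lie asymptotically between `R k / k - L / k` and
`R k / k` for all `k` in an arithmetic progression, then all of them and `R k / k` have the same
limit, the infimum of `R k / k` over the progression. -/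
theorem exists_tendsto_of_progression {ι : Type*} [Nonempty ι] {a : ι → ℕ → ℝ} {R : ℕ → ℝ}
    {D : ℕ} (hD : 0 < D) {L : ℝ} (hR0 : ∀ k, 0 ≤ R k) (hR : Monotone R)
    (hU : ∀ c j, ∀ ε > 0, ∀ᶠ n in atTop, a c n ≤ R (D * j + 1) / (D * j + 1 : ℕ) + ε)
    (hLo : ∀ c j, ∀ ε > 0, ∀ᶠ n in atTop,
      R (D * j + 1) / (D * j + 1 : ℕ) - L / (D * j + 1 : ℕ) - ε ≤ a c n) :
    ∃ r, Tendsto (fun k : ℕ => R k / k) atTop (𝓝 r) ∧ ∀ c, Tendsto (a c) atTop (𝓝 r) := by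
  set g : ℕ → ℝ := fun j => R (D * j + 1) / (D * j + 1 : ℕ) with hg
  have hg0 : ∀ j, 0 ≤ g j := fun j => div_nonneg (hR0 _) (Nat.cast_nonneg _)
  have hbdd : BddBelow (Set.range g) := ⟨0, by rintro _ ⟨j, rfl⟩; exact hg0 j⟩
  have hprog : Tendsto (fun j : ℕ => D * j + 1) atTop atTop :=
    tendsto_atTop_mono (fun j => (Nat.le_mul_of_pos_left j hD).trans (Nat.le_succ _)) tendsto_id
  have hL : Tendsto (fun j : ℕ => L / (D * j + 1 : ℕ)) atTop (𝓝 0) :=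
    Tendsto.div_atTop tendsto_const_nhds (tendsto_natCast_atTop_atTop.comp hprog)
  set r := ⨅ j, g j with hr
  have hrg : ∀ j, r ≤ g j := fun j => ciInf_le hbdd j
  have hgr : ∀ j, g j ≤ r + L / (D * j + 1 : ℕ) := by
    intro j
    rw [← sub_le_iff_le_add]
    refine le_ciInf fun i => le_of_forall_pos_le_add fun ε hε => ?_
    obtain ⟨n, h1, h2⟩ := ((hU (Classical.arbitrary ι) i (ε / 2) (half_pos hε)).and
      (hLo (Classical.arbitrary ι) j (ε / 2) (half_pos hε))).exists
    simp only [hg]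
    linarith
  have hglim : Tendsto g atTop (𝓝 r) := by
    refine tendsto_of_tendsto_of_tendsto_of_le_of_le tendsto_const_nhds ?_ hrg hgr
    simpa using hL.const_add r
  refine ⟨r, ?_, fun c => ?_⟩
  · -- Compare `k` with its neighbours in the progression.
    set q : ℕ → ℕ := fun k => (k - 1) / D with hq
    have hqlim : Tendsto q atTop atTop :=
      (Nat.tendsto_div_const_atTop hD.ne').comp (tendsto_sub_atTop_nat 1)
    have hdiv : Tendsto (fun k : ℕ => (D : ℝ) / k) atTop (𝓝 0) :=
      tendsto_const_nhds.div_atTop tendsto_natCast_atTop_atTop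
    have hlow : Tendsto (fun k : ℕ => g (q k) * (1 - D / k)) atTop (𝓝 r) := by
      simpa using (hglim.comp hqlim).mul (hdiv.const_sub 1)
    have hupp : Tendsto (fun k : ℕ => g (q k + 1) * (1 + D / k)) atTop (𝓝 r) := by
      simpa using (hglim.comp ((tendsto_add_atTop_nat 1).comp hqlim)).mul (hdiv.const_add 1)
    refine tendsto_of_tendsto_of_tendsto_of_le_of_le' hlow hupp ?_ ?_
    · filter_upwards [eventually_gt_atTop 0] with k hk
      have hk0 : (0 : ℝ) < k := by exact_mod_cast hk
      have h1 : D * q k + 1 ≤ k := by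
        have := Nat.mul_div_le (k - 1) D
        simp only [hq]
        omega
      have h2 : k ≤ D * q k + 1 + D := by
        have h3 := Nat.lt_mul_div_succ (k - 1) hD
        rw [mul_add, mul_one] at h3
        simp only [hq]
        omega
      have h3 : (k : ℝ) ≤ (D * q k + 1 : ℕ) + D := by exact_mod_cast h2
      have hpos : (0 : ℝ) < (D * q k + 1 : ℕ) := by exact_mod_cast Nat.succ_pos _
      rw [le_div_iff₀ hk0]
      calc g (q k) * (1 - D / k) * k = g (q k) * (k - D) := by field_simp
        _ ≤ g (q k) * (D * q k + 1 : ℕ) :=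
            mul_le_mul_of_nonneg_left (by linarith) (hg0 _)
        _ = R (D * q k + 1) := div_mul_cancel₀ _ hpos.ne'
        _ ≤ R k := hR h1
    · filter_upwards [eventually_gt_atTop 0] with k hk
      have hk0 : (0 : ℝ) < k := by exact_mod_cast hk
      have h1 : D * (q k + 1) + 1 ≤ k + D := by
        have := Nat.mul_div_le (k - 1) D
        rw [mul_add, mul_one]
        simp only [hq]
        omega
      have h2 : k ≤ D * (q k + 1) + 1 := by
        have h3 := Nat.lt_mul_div_succ (k - 1) hD
        simp only [hq]
        omega
      have h3 : ((D * (q k + 1) + 1 : ℕ) : ℝ) ≤ k + D := by exact_mod_cast h1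
      have hpos : (0 : ℝ) < (D * (q k + 1) + 1 : ℕ) := by exact_mod_cast Nat.succ_pos _
      rw [div_le_iff₀ hk0]
      calc R k ≤ R (D * (q k + 1) + 1) := hR h2
        _ = g (q k + 1) * (D * (q k + 1) + 1 : ℕ) := (div_mul_cancel₀ _ hpos.ne').symm
        _ ≤ g (q k + 1) * (k + D) := mul_le_mul_of_nonneg_left h3 (hg0 _)
        _ = g (q k + 1) * (1 + D / k) * k := by field_simp
  · rw [Metric.tendsto_atTop']
    intro ε hε
    obtain ⟨j, hj⟩ := (hL.eventually_lt_const (half_pos hε)).exists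
    obtain ⟨N, hN⟩ := eventually_atTop.1
      ((hU c j (ε / 2) (half_pos hε)).and (hLo c j (ε / 2) (half_pos hε)))
    refine ⟨N, fun n hn => ?_⟩
    obtain ⟨h1, h2⟩ := hN n hn.le
    rw [Real.dist_eq, abs_lt]
    have h3 := hrg j
    have h4 := hgr j
    simp only [hg] at h3 h4
    constructor <;> linarith

/-- The common limit of the optimal rates and of the normalized values of the marginals. -/
theorem IsSpectralPoint.exists_rate {f : GraphParameter.{u}} (hf : IsSpectralPoint f) {V : Type u}
    [Fintype V] [MeasurableSpace V] [DiscreteMeasurableSpace V] (G : SimpleGraph V)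
    {P : stdSimplex ℝ (V × V)} (hP : IsIrreducibleStationary P) :
    ∃ r : ℝ, Tendsto (fun n : ℕ => typeRate f (strongPower G n)
        (probVector (blockLaw (markovMeasure P) n)) / n) atTop (𝓝 r) ∧
      ∀ c : ℝ, 0 < c → c < 1 → Tendsto (minRate f G (markovMeasure P) c) atTop (𝓝 r) := by
  have h := hP.isIrreducibleChain
  obtain ⟨D, hD0, hD⟩ := h.exists_return_length
  obtain ⟨C, hC1, hC⟩ := h.exists_le_mul
  have : Nonempty (Set.Ioo (0 : ℝ) 1) := ⟨⟨1 / 2, by norm_num, by norm_num⟩⟩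
  obtain ⟨r, hr, hrc⟩ := exists_tendsto_of_progression (ι := Set.Ioo (0 : ℝ) 1)
    (a := fun c => minRate f G (markovMeasure P) c) hD0
    (fun k => hf.typeRate_nonneg (strongPower G k) (probVector (blockLaw (markovMeasure P) k)).2)
    (hf.monotone_typeRate_blockLaw G (markovMeasure P))
    (fun c j _ hε => hf.eventually_minRate_le G h hD j c.2.1 c.2.2 hε)
    (fun c j _ hε => hf.eventually_le_minRate G h hD hC1 hC j c.2.1 c.2.2 hε)
  exact ⟨r, hr, fun c hc0 hc1 => hrc ⟨c, hc0, hc1⟩⟩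

end AmbiguousAlphabet

open AmbiguousAlphabet in
theorem mainTheorem1 {V : Type u} [Fintype V] [MeasurableSpace V] [DiscreteMeasurableSpace V]
    (G : SimpleGraph V) (P : stdSimplex ℝ (V × V)) (hP : IsIrreducibleStationary P) :
    HasAEP G (markovMeasure P) ∧
      ∀ f : GraphParameter.{u}, IsSpectralPoint f →
        (∃! F : ProbabilisticGraphParameter.{u}, IsProbabilisticRefinement f F) ∧
        ∀ F : ProbabilisticGraphParameter.{u}, IsProbabilisticRefinement f F →
          ∃ r : ℝ, IsFRate F G (markovMeasure P) r ∧
            ∀ c : ℝ, 0 < c → c < 1 →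
              Tendsto (minRate f G (markovMeasure P) c) atTop (𝓝 r) := by
  refine ⟨fun f hf => ?_, fun f hf => ⟨hf.existsUnique_refinement, fun F hF => ?_⟩⟩
  · obtain ⟨r, _, hr⟩ := hf.exists_rate G hP
    exact ⟨r, hr⟩
  · obtain ⟨r, hr, hrc⟩ := hf.exists_rate G hP
    refine ⟨r, hr.congr fun n => ?_, hrc⟩
    rw [hf.refinement_eq_typeRate hF, one_div_mul_eq_div]
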